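/- Let $\sigma:(0,\infty)\to\mathbb R$, put $W(p)=\int_1^p\sigma(z)\,dz$, and assume: (H1) $\sigma$ is locally Lipschitz continuous on $(0,\infty)$; (H2) $\sigma(p)\to-\infty$ as $p\to0+$; (L1) there are $\alpha>0$ and $\theta>0$ with $\sigma'(p)\ge\alpha$ for a.e. $p\in(0,\theta)$; (U1) $W(p)$ is strictly convex for $p$ sufficiently large; (U2) $\sigma(p)>0$ for $p$ sufficiently large and $\int_{p_++1}^\infty \frac{dz}{\sigma(z)}<\infty$, where $p_+$ is the largest root of $\sigma$. Let $\mu>0$. For $p_0\in L^2(0,1)$ with $p_0\ge0$ a.e. and $\int_0^1p_0\,dx=\mu$, and $T>0$, a function $p=p(x,t)$ is called a solution on $(0,1)\times[0,T]$ of $$(P)\qquad p_t(x,t)=-\sigma(p(x,t))+\int_0^1\sigma(p(y,t))\,dy,\qquad p(x,0)=p_0(x),\qquad \int_0^1p(x,t)\,dx=\mu ,$$ if (i) $p\in C([0,T];L^2(0,1))$ and $p(\cdot,0)=p_0$; (ii) $p(x,t)>0$ for a.e. $(x,t)\in(0,1)\times[0,T]$, $\sigma(p(\cdot,t))\in L^1(0,1)$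 for a.e. $t\in[0,T]$, and, for a.e. $x\in(0,1)$ and all $\tau>0$, $\sigma(p(x,\cdot))-\int_0^1\sigma(p(y,\cdot))\,dy\in L^1(\tau,T)$; (iii) for a.e. $x\in(0,1)$ and all $s,t\in(0,T]$, $$p(x,t)=p(x,s)-\int_s^t\Big(\sigma(p(x,r))-\int_0^1\sigma(p(y,r))\,dy\Big)dr .$$ (The mean constraint $\int_0^1p(x,t)\,dx=\mu$ is not part of (i)-(iii); it is asserted below.) Then there exist functions $\varepsilon:[0,\infty)\to\mathbb R$ and $E:(0,\infty)\to\mathbb R$, depending only on $\sigma$ and $\mu$ (in particular independent of the initial data), such that $\varepsilon$ is continuous and nondecreasing with $\varepsilon(0)=0$ and $0<\varepsilon(t)<\mu$ for $t>0$; $E$ is continuous and nonincreasing with $\lim_{t\to0+}E(t)=\infty$ and $E(t)>\mu$ for $t>0$; and the following holds. For every $p_0\in L^2(0,1)$ with $p_0\ge0$ a.e. and $\int_0^1p_0\,dx=\mu$ there is a function $p$ on $(0,1)\times[0,\infty)$ that is a solution of (P) on $(0,1)\times[0,T]$ for every $T>0$ and satisfies $\int_0^1p(x,t)\,dx=\mu$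 for all $t\ge0$; it is unique, in the sense that for every $T>0$ any solution $q$ on $(0,1)\times[0,T]$ with the same $p_0$ satisfies $q(\cdot,t)=p(\cdot,t)$ a.e. for all $t\in[0,T]$; and for all $t>0$ $$\varepsilon(t)\le p(x,t)\le E(t)\qquad\text{for a.e. }x\in(0,1).$$ -/

import Mathlib

open Set Filter Topology MeasureTheory

namespace QuasistaticVisco

/-- The stored-energy function `W(p) = ∫_1^p σ(z) dz` of the elastic stress `σ`. Only the values
of `σ` on `(0, ∞)` matter for `p > 0`. -/
noncomputable def storedEnergy (σ : ℝ → ℝ) (p : ℝ) : ℝ := ∫ z in (1 : ℝ)..p, σ z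

/-- (H1) `σ : (0, ∞) → ℝ` is locally Lipschitz. -/
def H1 (σ : ℝ → ℝ) : Prop :=
  ∀ C : ℝ, 1 < C → ∃ L : NNReal, LipschitzOnWith L σ (Icc (1 / C) C)

/-- (H2) `σ(p) → -∞` as `p → 0+`. -/
def H2 (σ : ℝ → ℝ) : Prop := Tendsto σ (𝓝[>] 0) atBot

/-- (L1) `σ' ≥ α > 0` near `0`. As `σ` is only locally Lipschitz, its derivative is understood
almost everywhere. (As `α > 0`, the inequality forces differentiability at the point.) -/
def L1 (σ : ℝ → ℝ) : Prop :=
  ∃ α : ℝ, 0 < α ∧ ∃ θ : ℝ, 0 < θ ∧ ∀ᵐ p ∂(volume.restrict (Ioo 0 θ)), α ≤ deriv σ p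

/-- (U1) `W` is strictly convex for sufficiently large arguments. -/
def U1 (σ : ℝ → ℝ) : Prop :=
  ∃ R : ℝ, 0 < R ∧ StrictConvexOn ℝ (Ioi R) (storedEnergy σ)

/-- (U2) `σ > 0` for sufficiently large arguments, and `∫_{p₊+1}^∞ dz/σ(z) < ∞`, where `p₊` is
the largest root of `σ` in `(0, ∞)`. -/
def U2 (σ : ℝ → ℝ) : Prop :=
  (∀ᶠ p in atTop, 0 < σ p) ∧
    ∃ pPlus : ℝ, IsGreatest {p : ℝ | 0 < p ∧ σ p = 0} pPlus ∧
      IntegrableOn (fun z => 1 / σ z) (Ioi (pPlus + 1))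

/-- Lebesgue measure on the interval `(0, 1)`. -/
noncomputable abbrev unitMeasure : Measure ℝ := volume.restrict (Ioo 0 1)

/-- `p = p(x, t)` is a solution on `(0, 1) × [0, T]` of
`p_t = -σ(p) + ∫_0^1 σ(p(y, t)) dy`, `p(·, 0) = p₀`. -/
structure IsSolution (σ : ℝ → ℝ) (p₀ : ℝ → ℝ) (T : ℝ) (p : ℝ → ℝ → ℝ) : Prop where
  /-- `p ∈ C([0, T]; L²(0, 1))`. -/
  continuous : ∃ u : ℝ → Lp ℝ 2 unitMeasure, ContinuousOn u (Icc 0 T) ∧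
    ∀ t ∈ Icc 0 T, u t =ᵐ[unitMeasure] fun x => p x t
  /-- `p(·, 0) = p₀`. -/
  initial : (fun x => p x 0) =ᵐ[unitMeasure] p₀
  /-- `p(x, t) > 0` for a.e. `(x, t)`. -/
  pos : ∀ᵐ z : ℝ × ℝ ∂(volume.restrict (Ioo 0 1 ×ˢ Icc 0 T)), 0 < p z.1 z.2
  /-- `σ(p(·, t)) ∈ L¹(0, 1)` for a.e. `t`. -/
  stress_integrable : ∀ᵐ t ∂(volume.restrict (Icc 0 T)),
    Integrable (fun x => σ (p x t)) unitMeasure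
  /-- `σ(p(x, ·)) - ∫_0^1 σ(p(y, ·)) dy ∈ L¹(τ, T)` for a.e. `x` and all `τ > 0`. -/
  rhs_integrable : ∀ᵐ x ∂unitMeasure, ∀ τ : ℝ, 0 < τ →
    IntegrableOn (fun s => σ (p x s) - ∫ y, σ (p y s) ∂unitMeasure) (Ioo τ T)
  /-- The integrated equation, for a.e. `x` and all positive times. -/
  equation : ∀ᵐ x ∂unitMeasure, ∀ s ∈ Ioc 0 T, ∀ t ∈ Ioc 0 T,
    p x t = p x s - ∫ τ in s..t, (σ (p x τ) - ∫ y, σ (p y τ) ∂unitMeasure)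

end QuasistaticVisco

/-!
# Well-posedness and uniform bounds for a nonlocal quasistatic viscoelastic equation

For a given mean stress `S(t) = ∫ σ(p(y, t)) dy` the equation decouples into the scalar equations
`p' = S - σ(p)`, one for each `x`. The hypotheses make `σ` one-sided Lipschitz on all of `(0, ∞)`:
it is monotone near `0` and near infinity and Lipschitz in between (`Admissible`,
`admissible_of_hypotheses`). Two consequences carry the argument.

* Trajectories keep their order (`Flow.le_of_le`). The difference of a trajectory `p(x)` and a
  bounded trajectory `p(y)` no longer contains `S` and satisfies `z' ≤ M - σ(z)` for large `z`; as
  `1 / σ` is integrable, it comes down from infinity in a time that does not depend on its initial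
  value (`Admissible.exists_bound_of_descent`, `Flow.exists_upper_bound`). For the lower bound,
  suppose that `p ≤ E` and that the mean is `m`. Then the lowest trajectory rises at rate at least
  `m / (2 E)` while it is small, since its stress lies below that of every other trajectory, and by
  a fixed amount below that of the trajectories above `m / 2` (`Flow.exists_lower_bound`).
* Two solutions with the same mean satisfy `‖p(t) - q(t)‖ ≤ exp(L (t - s)) ‖p(s) - q(s)‖` in `L²`,
  because the nonlocal terms are constant in `x` and hence orthogonal to `p - q`
  (`Flow.integral_sq_sub_le`).

The definition of a solution does not contain the conservation of mean, and the equation is not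
known a priori to be integrable in `(x, t)`. It becomes integrable as soon as one trajectory is
bounded and bounded away from `0`. Order preservation provides such a trajectory on every time
interval on which the mean stays positive (`Flow.exists_trajectory_le`,
`Flow.exists_le_trajectory`), and a continuity argument gives the conservation of mean on the whole
interval (`IsSolution.integral_eq`). Uniqueness follows from `L²` stability on `[τ, T]` as `τ → 0`
(`IsSolution.unique`).

For existence, initial values in a compact subset of `(0, ∞)` lead to an ordinary differential
equation in a space of continuous functions (`exists_regularFlow`). General initial values are
approximated with the mean kept fixed (`exists_approx_initial`). By `L²` stability the approximate
solutions converge, and the bounds, which are uniform at positive times, pass to the limit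
(`exists_solution_of_approx`).
-/

namespace QuasistaticVisco

/-! ### Primitives of integrable functions -/

/-- `z` is a primitive of the integrable function `h` on `[s, t]`. -/
def IsPrimitiveOn (z h : ℝ → ℝ) (s t : ℝ) : Prop :=
  IntegrableOn h (Icc s t) ∧
    ∀ a ∈ Icc s t, ∀ b ∈ Icc s t, z b = z a + ∫ r in a..b, h r

namespace IsPrimitiveOn

variable {z h w g : ℝ → ℝ} {s t : ℝ}

lemma intervalIntegrable (hz : IsPrimitiveOn z h s t) {a b : ℝ} (ha : a ∈ Icc s t)
    (hb : b ∈ Icc s t) : IntervalIntegrable h volume a b :=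
  (hz.1.mono_set (ordConnected_Icc.uIcc_subset ha hb)).intervalIntegrable

lemma mono (hz : IsPrimitiveOn z h s t) {a b : ℝ} (ha : s ≤ a) (hb : b ≤ t) :
    IsPrimitiveOn z h a b :=
  ⟨hz.1.mono_set (Icc_subset_Icc ha hb), fun c hc d hd =>
    hz.2 c (Icc_subset_Icc ha hb hc) d (Icc_subset_Icc ha hb hd)⟩

lemma sub (hz : IsPrimitiveOn z h s t) (hw : IsPrimitiveOn w g s t) :
    IsPrimitiveOn (fun r => z r - w r) (fun r => h r - g r) s t := by
  refine ⟨hz.1.sub hw.1, fun a ha b hb => ?_⟩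
  simp only [intervalIntegral.integral_sub (hz.intervalIntegrable ha hb)
    (hw.intervalIntegrable ha hb), hz.2 a ha b hb, hw.2 a ha b hb]
  ring

lemma sub_const (hz : IsPrimitiveOn z h s t) (c : ℝ) :
    IsPrimitiveOn (fun r => z r - c) h s t := by
  refine ⟨hz.1, fun a ha b hb => ?_⟩
  simp only [hz.2 a ha b hb]
  ring

lemma neg (hz : IsPrimitiveOn z h s t) :
    IsPrimitiveOn (fun r => - z r) (fun r => - h r) s t := by
  refine ⟨hz.1.neg, fun a ha b hb => ?_⟩
  simp only [intervalIntegral.integral_neg, hz.2 a ha b hb]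
  ring

lemma continuousOn (hz : IsPrimitiveOn z h s t) : ContinuousOn z (Icc s t) := by
  rcases lt_or_ge t s with hst | hst
  · simp [Icc_eq_empty_of_lt hst]
  have h1 : ContinuousOn (fun r => z s + ∫ u in s..r, h u) (Icc s t) := by
    have := intervalIntegral.continuousOn_primitive_interval (μ := volume) (f := h) (a := s) (b := t)
      (by rw [uIcc_of_le hst]; exact hz.1)
    rw [uIcc_of_le hst] at this
    exact continuousOn_const.add this
  exact h1.congr fun r hr => hz.2 s (left_mem_Icc.2 hst) r hr

lemma of_hasDerivAt (hh : Continuous h) (hz : ∀ r, HasDerivAt z (h r) r) (s t : ℝ) :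
    IsPrimitiveOn z h s t := by
  refine ⟨hh.integrableOn_Icc, fun a _ b _ => ?_⟩
  rw [intervalIntegral.integral_eq_sub_of_hasDerivAt (fun r _ => hz r)
    (hh.intervalIntegrable _ _)]
  ring

/-- The product rule for squares, through the product rule for absolutely continuous functions. -/
lemma sq (hz : IsPrimitiveOn z h s t) :
    IsPrimitiveOn (fun r => z r ^ 2) (fun r => 2 * z r * h r) s t := by
  refine ⟨?_, fun a ha b hb => ?_⟩
  · exact hz.1.continuousOn_mul (hz.continuousOn.const_smul (2 : ℝ)) isCompact_Icc
  · have hi := hz.intervalIntegrable ha hb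
    have hac := hi.absolutelyContinuousOnInterval_intervalIntegral (c := a) left_mem_uIcc
    have hsub : uIcc a b ⊆ Icc s t := ordConnected_Icc.uIcc_subset ha hb
    have hac' : AbsolutelyContinuousOnInterval (fun r => z a + ∫ u in a..r, h u) a b := by
      have hc : AbsolutelyContinuousOnInterval (fun _ : ℝ => z a) a b :=
        (LipschitzWith.const (z a)).lipschitzOnWith.absolutelyContinuousOnInterval (K := 0)
      exact hc.add hac
    have key := hac'.integral_deriv_mul_eq_sub hac'
    simp only [intervalIntegral.integral_same, add_zero] at key
    rw [← hz.2 a ha b hb] at key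
    have : ∫ r in a..b, 2 * z r * h r = z b * z b - z a * z a := by
      rw [← key]
      apply intervalIntegral.integral_congr_ae
      filter_upwards [hi.ae_hasDerivAt_integral] with r hr hrab
      have hr' := uIoc_subset_uIcc hrab
      have hd := ((hr hr' a left_mem_uIcc).const_add (z a)).deriv
      rw [hd, ← hz.2 a ha r (hsub hr')]
      ring
    rw [this]
    ring

/-- Comparison principle: a primitive that starts nonpositive and whose derivative is at most
`L z` wherever `z` is positive stays nonpositive. -/
lemma nonpos {L : ℝ} (hz : IsPrimitiveOn z h s t) (hst : s ≤ t) (hL : 0 ≤ L) (h0 : z s ≤ 0)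
    (hle : ∀ᵐ r ∂volume.restrict (Icc s t), 0 < z r → h r ≤ L * z r) : z t ≤ 0 := by
  by_contra! hzt
  have hcont := hz.continuousOn
  -- the last time at which `z` is nonpositive
  obtain ⟨a, ⟨haI, hza⟩, hamax⟩ : ∃ a, IsGreatest (Icc s t ∩ z ⁻¹' Iic 0) a :=
    (isCompact_Icc.of_isClosed_subset (hcont.preimage_isClosed_of_isClosed isClosed_Icc isClosed_Iic)
      inter_subset_left).exists_isGreatest ⟨s, left_mem_Icc.2 hst, h0⟩
  have hpos : ∀ r, a < r → r ≤ t → 0 < z r := by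
    intro r har hrt
    by_contra! hr
    exact absurd (hamax ⟨⟨haI.1.trans har.le, hrt⟩, hr⟩) (not_le.2 har)
  have hat : a < t := by
    rcases haI.2.lt_or_eq with h | h
    · exact h
    · exact absurd (h ▸ hza : z t ≤ 0) (not_le.2 hzt)
  -- on a short interval after `a` the maximum of `z` would be at most half of itself
  set b := min t (a + 1 / (2 * (L + 1))) with hb
  have hab : a < b := lt_min hat (by have : 0 < 1 / (2 * (L + 1)) := by positivity
                                     linarith)
  have hbt : b ≤ t := min_le_left _ _
  obtain ⟨c, hc, hcmax⟩ := isCompact_Icc.exists_isMaxOn (nonempty_Icc.2 hab.le)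
    (hcont.mono (Icc_subset_Icc haI.1 hbt))
  have hm : 0 < z c := (hpos b hab hbt).trans_le (hcmax (right_mem_Icc.2 hab.le))
  have hcI : c ∈ Icc s t := ⟨haI.1.trans hc.1, hc.2.trans hbt⟩
  have hle' : ∫ r in a..c, h r ≤ ∫ r in a..c, L * z c := by
    apply intervalIntegral.integral_mono_ae_restrict hc.1 (hz.intervalIntegrable haI hcI)
      intervalIntegrable_const
    have hsub : Ioc a c ⊆ Icc s t := fun r hr => ⟨haI.1.trans hr.1.le, hr.2.trans hcI.2⟩
    rw [← restrict_Ioc_eq_restrict_Icc]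
    filter_upwards [ae_restrict_of_ae_restrict_of_subset hsub hle,
      ae_restrict_mem measurableSet_Ioc] with r hr hrI
    refine (hr (hpos r hrI.1 (hrI.2.trans hcI.2))).trans ?_
    exact mul_le_mul_of_nonneg_left (hcmax ⟨hrI.1.le, hrI.2.trans hc.2⟩) hL
  rw [intervalIntegral.integral_const, smul_eq_mul] at hle'
  have hzc := hz.2 a haI c hcI
  have hca : c - a ≤ 1 / (2 * (L + 1)) := by
    have := hc.2.trans (min_le_right _ _)
    linarith
  have h2 : (c - a) * (L + 1) ≤ 1 / 2 := by
    calc (c - a) * (L + 1) ≤ 1 / (2 * (L + 1)) * (L + 1) := by gcongr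
      _ = 1 / 2 := by field_simp
  have hza' : z a ≤ 0 := hza
  have hca0 : 0 ≤ c - a := sub_nonneg.2 hc.1
  nlinarith [mul_le_mul_of_nonneg_right h2 hm.le, mul_nonneg hca0 hm.le]

/-- A level that the derivative does not allow to be crossed upwards is a barrier. -/
lemma le_of_barrier {A : ℝ} (hz : IsPrimitiveOn z h s t) (hst : s ≤ t) (h0 : z s ≤ A)
    (hle : ∀ᵐ r ∂volume.restrict (Icc s t), A < z r → h r ≤ 0) : z t ≤ A := by
  have := (hz.sub_const A).nonpos hst le_rfl (by linarith) (by
    filter_upwards [hle] with r hr hpos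
    have := hr (by linarith)
    linarith)
  linarith

/-- A primitive that decreases at rate at least `c` while above the level `A`. -/
lemma le_max_of_descent {A c : ℝ} (hz : IsPrimitiveOn z h s t) (hst : s ≤ t) (hc : 0 ≤ c)
    (hle : ∀ᵐ r ∂volume.restrict (Icc s t), A < z r → h r ≤ -c) :
    z t ≤ max A (z s - c * (t - s)) := by
  by_contra! hlt
  rw [max_lt_iff] at hlt
  have habove : ∀ r ∈ Icc s t, A < z r := by
    intro r hr
    by_contra! hzr
    have := (hz.mono hr.1 le_rfl).le_of_barrier hr.2 hzr (by
      filter_upwards [ae_restrict_of_ae_restrict_of_subset (Icc_subset_Icc hr.1 le_rfl) hle]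
        with u hu hA
      have := hu hA
      linarith)
    linarith [hlt.1]
  have hint : ∫ r in s..t, h r ≤ ∫ r in s..t, -c := by
    apply intervalIntegral.integral_mono_ae_restrict hst
      (hz.intervalIntegrable (left_mem_Icc.2 hst) (right_mem_Icc.2 hst)) intervalIntegrable_const
    filter_upwards [hle, ae_restrict_mem measurableSet_Icc] with r hr hrI
    exact hr (habove r hrI)
  rw [intervalIntegral.integral_const, smul_eq_mul] at hint
  have := hz.2 s (left_mem_Icc.2 hst) t (right_mem_Icc.2 hst)
  linarith [hlt.2]

/-- One-sided Gronwall inequality. -/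
lemma le_gronwall {A L η : ℝ} (hz : IsPrimitiveOn z h s t) (hst : s ≤ t) (hL : 0 ≤ L)
    (hA : 0 ≤ A) (hη : 0 ≤ η) (h0 : z s ≤ A)
    (hle : ∀ᵐ r ∂volume.restrict (Icc s t), 0 < z r → h r ≤ L * z r + η) :
    z t ≤ (A + η * (t - s)) * Real.exp (L * (t - s)) := by
  set φ : ℝ → ℝ := fun r => (A + η * (r - s)) * Real.exp (L * (r - s)) with hφ
  set φ' : ℝ → ℝ := fun r => η * Real.exp (L * (r - s)) + L * φ r with hφ'
  have hd : ∀ r, HasDerivAt φ (φ' r) r := by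
    intro r
    have h1 : HasDerivAt (fun r => A + η * (r - s)) (η * 1) r :=
      (((hasDerivAt_id r).sub_const s).const_mul η).const_add A
    have h2 : HasDerivAt (fun r => Real.exp (L * (r - s)))
        (Real.exp (L * (r - s)) * (L * 1)) r :=
      (((hasDerivAt_id r).sub_const s).const_mul L).exp
    refine (h1.mul h2).congr_deriv ?_
    change _ = η * Real.exp (L * (r - s)) + L * ((A + η * (r - s)) * Real.exp (L * (r - s)))
    ring
  have hφ'c : Continuous φ' := by
    simp only [hφ', hφ]
    fun_prop
  have hw := hz.sub (IsPrimitiveOn.of_hasDerivAt hφ'c hd s t)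
  have := hw.nonpos hst hL (by simp [hφ, h0]) (by
    filter_upwards [hle, ae_restrict_mem measurableSet_Icc] with r hr hrI hpos
    have hrs : 0 ≤ r - s := sub_nonneg.2 hrI.1
    have hφ0 : 0 ≤ φ r := by simp only [hφ]; positivity
    have h1 := hr (by linarith)
    have h2 : 1 ≤ Real.exp (L * (r - s)) := Real.one_le_exp (by positivity)
    have h3 : η * 1 ≤ η * Real.exp (L * (r - s)) := mul_le_mul_of_nonneg_left h2 hη
    simp only [hφ']
    nlinarith)
  simpa [hφ] using this

end IsPrimitiveOn

lemma IsPrimitiveOn.congr {z h z' h' : ℝ → ℝ} {s t : ℝ} (hz : IsPrimitiveOn z h s t)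
    (hzz : EqOn z' z (Icc s t)) (hhh : h' =ᵐ[volume.restrict (Icc s t)] h) :
    IsPrimitiveOn z' h' s t := by
  refine ⟨hz.1.congr hhh.symm, fun a ha b hb => ?_⟩
  have hsub : uIoc a b ⊆ Icc s t :=
    uIoc_subset_uIcc.trans (ordConnected_Icc.uIcc_subset ha hb)
  rw [hzz ha, hzz hb, hz.2 a ha b hb, intervalIntegral.integral_congr_ae_restrict
    (ae_restrict_of_ae_restrict_of_subset hsub hhh)]

/-- Pointwise limits of primitives with uniformly bounded derivatives. -/
lemma IsPrimitiveOn.of_tendsto {z h : ℕ → ℝ → ℝ} {w k : ℝ → ℝ} {s t C : ℝ}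
    (hz : ∀ n, IsPrimitiveOn (z n) (h n) s t)
    (hzw : ∀ r ∈ Icc s t, Tendsto (fun n => z n r) atTop (𝓝 (w r)))
    (hhk : ∀ r ∈ Icc s t, Tendsto (fun n => h n r) atTop (𝓝 (k r)))
    (hC : ∀ n, ∀ r ∈ Icc s t, |h n r| ≤ C) : IsPrimitiveOn w k s t := by
  have hlim : ∀ᵐ r ∂volume.restrict (Icc s t), Tendsto (fun n => h n r) atTop (𝓝 (k r)) := by
    filter_upwards [ae_restrict_mem measurableSet_Icc] with r hr using hhk r hr
  have hkm : AEStronglyMeasurable k (volume.restrict (Icc s t)) :=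
    aestronglyMeasurable_of_tendsto_ae atTop (fun n => (hz n).1.aestronglyMeasurable) hlim
  refine ⟨Integrable.of_bound hkm C ?_, fun a ha b hb => ?_⟩
  · filter_upwards [ae_restrict_mem measurableSet_Icc] with r hr
    exact le_of_tendsto (hhk r hr).norm (Eventually.of_forall fun n => hC n r hr)
  · have hsub : uIoc a b ⊆ Icc s t :=
      uIoc_subset_uIcc.trans (ordConnected_Icc.uIcc_subset ha hb)
    have h1 : Tendsto (fun n => ∫ r in a..b, h n r) atTop (𝓝 (∫ r in a..b, k r)) := by
      refine intervalIntegral.tendsto_integral_filter_of_dominated_convergence (fun _ => C)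
        (Eventually.of_forall fun n =>
          (hz n).1.aestronglyMeasurable.mono_measure (Measure.restrict_mono hsub le_rfl))
        (Eventually.of_forall fun n => ae_of_all _ fun r hr => hC n r (hsub hr))
        intervalIntegrable_const (ae_of_all _ fun r hr => hhk r (hsub hr))
    have h2 := (hzw a ha).add h1
    refine tendsto_nhds_unique (hzw b hb) (h2.congr fun n => ?_)
    exact ((hz n).2 a ha b hb).symm

instance : IsProbabilityMeasure unitMeasure := ⟨by simp⟩

/-- A primitive of space-dependent integrands may be averaged over space. -/
lemma IsPrimitiveOn.integral_unitMeasure {u h : ℝ → ℝ → ℝ} {s t : ℝ}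
    (hu : ∀ x, IsPrimitiveOn (u x) (h x) s t)
    (hint : Integrable (fun z : ℝ × ℝ => h z.2 z.1) ((volume.restrict (Icc s t)).prod unitMeasure))
    (hui : ∀ r ∈ Icc s t, Integrable (fun x => u x r) unitMeasure) :
    IsPrimitiveOn (fun r => ∫ x, u x r ∂unitMeasure) (fun r => ∫ x, h x r ∂unitMeasure) s t := by
  refine ⟨hint.integral_prod_left, fun a ha b hb => ?_⟩
  have hsub : uIoc a b ⊆ Icc s t :=
    uIoc_subset_uIcc.trans (ordConnected_Icc.uIcc_subset ha hb)
  have hswap := intervalIntegral_integral_swap (a := a) (b := b) (μ := unitMeasure)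
    (f := fun r x => h x r)
    (hint.mono_measure (Measure.prod_mono (Measure.restrict_mono hsub le_rfl) le_rfl))
  rw [hswap, ← sub_eq_iff_eq_add', ← integral_sub (hui b hb) (hui a ha)]
  congr 1
  ext x
  rw [(hu x).2 a ha b hb]
  ring

/-! ### Quantiles and monotone envelopes -/

/-- Almost minimal points: however small `δ` is, some point has fewer than `δ` of the mass strictly
below it. -/
lemma exists_measure_lt_lt {α : Type*} [MeasurableSpace α] [Nonempty α] (ν : Measure α)
    [IsFiniteMeasure ν] {g : α → ℝ} (hg : Measurable g) {δ : ENNReal} (hδ : 0 < δ) :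
    ∃ y, ν {x | g x < g y} < δ := by
  by_contra! h
  have hmeas : ∀ c, NullMeasurableSet {x | g x < c} ν := fun c =>
    (measurableSet_lt hg measurable_const).nullMeasurableSet
  have hlim : ∀ c : ℕ → ℝ, Antitone c → (∀ x, ∃ n, c n ≤ g x) → ∃ n, ν {x | g x < c n} < δ := by
    intro c hc hcg
    have hT := tendsto_measure_iInter_atTop (μ := ν) (s := fun n => {x | g x < c n})
      (fun n => hmeas _) (fun i j hij x hx => lt_of_lt_of_le hx (hc hij))
      ⟨0, measure_ne_top _ _⟩
    have hempty : ⋂ n, {x | g x < c n} = ∅ := by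
      ext x
      obtain ⟨n, hn⟩ := hcg x
      simp only [mem_iInter, mem_ofPred_eq, mem_empty_iff_false, iff_false, not_forall, not_lt]
      exact ⟨n, hn⟩
    rw [hempty, measure_empty] at hT
    exact (hT.eventually (gt_mem_nhds hδ)).exists
  set A : Set ℝ := {c | δ ≤ ν {x | g x < c}} with hA
  obtain ⟨n, hn⟩ := hlim (fun n => -(n : ℝ))
    (fun i j hij => neg_le_neg (by exact_mod_cast hij)) (fun x => by
      obtain ⟨n, hn⟩ := exists_nat_ge (-g x)
      exact ⟨n, by linarith⟩)
  have hbdd : BddBelow A := by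
    refine ⟨-(n : ℝ), fun c hc => ?_⟩
    by_contra! hlt
    exact absurd (hc.trans (measure_mono fun x hx => lt_trans hx hlt)) (not_le.2 hn)
  have hne : A.Nonempty := ⟨g (Classical.arbitrary α), h _⟩
  have hge : ∀ y, sInf A ≤ g y := fun y => csInf_le hbdd (h y)
  have hgt : ∀ y, sInf A < g y := by
    intro y
    refine lt_of_le_of_ne (hge y) fun heq => ?_
    have : {x | g x < g y} = ∅ := by
      ext x
      simpa [← heq] using hge x
    exact absurd (h y) (by rw [this, measure_empty]; exact not_le.2 hδ)
  obtain ⟨n, hn⟩ := hlim (fun n => sInf A + 1 / ((n : ℝ) + 1))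
    (fun i j hij => by
      have : (i : ℝ) ≤ j := by exact_mod_cast hij
      simp only
      gcongr)
    (fun x => by
      obtain ⟨n, hn⟩ := exists_nat_one_div_lt (sub_pos.2 (hgt x))
      exact ⟨n, by linarith⟩)
  obtain ⟨c, hc, hclt⟩ := exists_lt_of_csInf_lt hne
    (show sInf A < sInf A + 1 / ((n : ℝ) + 1) from lt_add_of_pos_right _ Nat.one_div_pos_of_nat)
  exact absurd (hc.trans (measure_mono fun x hx => lt_trans hx hclt)) (not_le.2 hn)

/-- Bounds that hold uniformly on each `[τ, ∞)`, `τ > 0`, can be given by one continuous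
nonincreasing function. Averaging a monotone bound over `[t / 2, t]` makes it continuous. -/
lemma exists_continuous_antitone_bound (P : ℝ → ℝ → Prop)
    (hmono : ∀ t B B', B ≤ B' → P t B → P t B')
    (h : ∀ τ, 0 < τ → ∃ B, ∀ t, τ ≤ t → P t B) (m : ℝ) :
    ∃ E : ℝ → ℝ, ContinuousOn E (Ioi 0) ∧ AntitoneOn E (Ioi 0) ∧ Tendsto E (𝓝[>] 0) atTop ∧
      ∀ t, 0 < t → m < E t ∧ P t (E t) := by
  set S : ℝ → Set ℝ := fun τ => {B | 0 ≤ B ∧ ∀ t, τ ≤ t → P t B} with hS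
  have hSne : ∀ τ, 0 < τ → (S τ).Nonempty := by
    intro τ hτ
    obtain ⟨B, hB⟩ := h τ hτ
    exact ⟨max B 0, le_max_right _ _, fun t ht => hmono t _ _ (le_max_left _ _) (hB t ht)⟩
  have hSbdd : ∀ τ, BddBelow (S τ) := fun τ => ⟨0, fun B hB => hB.1⟩
  set b : ℝ → ℝ := fun τ => sInf (S τ) + 1 with hb
  have hb0 : ∀ τ, 0 ≤ b τ := fun τ => by
    have : 0 ≤ sInf (S τ) := Real.sInf_nonneg fun B hB => hB.1
    simp only [hb]
    linarith
  have hbanti : AntitoneOn b (Ioi 0) := by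
    intro s hs t _ hst
    have : sInf (S t) ≤ sInf (S s) :=
      csInf_le_csInf (hSbdd t) (hSne s hs) fun B hB => ⟨hB.1, fun r hr => hB.2 r (hst.trans hr)⟩
    simp only [hb]
    linarith
  have hbP : ∀ t, 0 < t → P t (b t) := by
    intro t ht
    obtain ⟨B, hB, hlt⟩ := exists_lt_of_csInf_lt (hSne t ht) (lt_add_one (sInf (S t)))
    exact hmono t _ _ hlt.le (hB.2 t le_rfl)
  have hint : ∀ s t, 0 < s → 0 < t → IntervalIntegrable b volume s t := fun s t hs ht =>
    (hbanti.mono fun r hr => (lt_min hs ht).trans_le hr.1).intervalIntegrable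
  have hinner : ∀ t, 0 < t → AntitoneOn (fun u => b (t * u)) (Icc (1 / 2) 1) := by
    intro t ht u hu v hv huv
    have hu0 : 0 < u := lt_of_lt_of_le (by norm_num) hu.1
    exact hbanti (mul_pos ht hu0) (mul_pos ht (hu0.trans_le huv)) (by gcongr)
  have hint' : ∀ t, 0 < t → IntervalIntegrable (fun u => b (t * u)) volume (1 / 2) 1 :=
    fun t ht => AntitoneOn.intervalIntegrable
      (by rw [uIcc_of_le (by norm_num)]; exact hinner t ht)
  have havg : ∀ t, 0 < t → b t ≤ 2 * ∫ u in (1 / 2 : ℝ)..1, b (t * u) := by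
    intro t ht
    have h1 : ∫ u in (1 / 2 : ℝ)..1, b t ≤ ∫ u in (1 / 2 : ℝ)..1, b (t * u) := by
      apply intervalIntegral.integral_mono_on (by norm_num) intervalIntegrable_const (hint' t ht)
      intro u hu
      simpa using hinner t ht hu (right_mem_Icc.2 (by norm_num)) hu.2
    rw [intervalIntegral.integral_const, smul_eq_mul] at h1
    linarith
  have hprim : ContinuousOn (fun t => ∫ r in (1 : ℝ)..t, b r) (Ioi 0) := by
    intro t ht
    have ht' : (0 : ℝ) < t := ht
    have hc := intervalIntegral.continuousOn_primitive_interval' (a := 1)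
      (hint (min (t / 2) 1) (max (2 * t) 1) (by positivity) (by positivity))
      (by rw [uIcc_of_le ((min_le_right _ _).trans (le_max_right _ _))]
          exact ⟨min_le_right _ _, le_max_right _ _⟩)
    rw [uIcc_of_le ((min_le_right _ _).trans (le_max_right _ _))] at hc
    refine (hc.continuousAt ?_).continuousWithinAt
    refine Icc_mem_nhds ((min_le_left _ _).trans_lt (by linarith))
      (lt_of_lt_of_le (by linarith) (le_max_left _ _))
  refine ⟨fun t => 2 * (∫ u in (1 / 2 : ℝ)..1, b (t * u)) + t⁻¹ + |m|, ?_, ?_, ?_, ?_⟩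
  · have hEq : EqOn (fun t => 2 * (∫ u in (1 / 2 : ℝ)..1, b (t * u)) + t⁻¹ + |m|)
        (fun t => 2 * (t⁻¹ * ((∫ r in (1 : ℝ)..t, b r) - ∫ r in (1 : ℝ)..t / 2, b r)) + t⁻¹ + |m|)
        (Ioi 0) := by
      intro t ht
      have ht' : (0 : ℝ) < t := ht
      simp only
      rw [intervalIntegral.integral_comp_mul_left _ ht'.ne', smul_eq_mul,
        intervalIntegral.integral_interval_sub_left (hint _ _ one_pos ht')
          (hint _ _ one_pos (by positivity))]
      congr 5 <;> ring
    have hinv : ContinuousOn (fun t : ℝ => t⁻¹) (Ioi 0) :=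
      continuousOn_inv₀.mono fun t ht => ne_of_gt ht
    have hhalf : ContinuousOn (fun t => ∫ r in (1 : ℝ)..t / 2, b r) (Ioi 0) :=
      hprim.comp (by fun_prop) fun t (ht : 0 < t) => half_pos ht
    refine ContinuousOn.congr ?_ hEq
    exact ((continuousOn_const.mul (hinv.mul (hprim.sub hhalf))).add hinv).add continuousOn_const
  · intro s hs t ht hst
    have hs' : (0 : ℝ) < s := hs
    have h1 : ∫ u in (1 / 2 : ℝ)..1, b (t * u) ≤ ∫ u in (1 / 2 : ℝ)..1, b (s * u) := by
      apply intervalIntegral.integral_mono_on (by norm_num) (hint' t ht) (hint' s hs)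
      intro u hu
      have hu0 : 0 < u := lt_of_lt_of_le (by norm_num) hu.1
      exact hbanti (mul_pos hs' hu0) (mul_pos (hs'.trans_le hst) hu0) (by gcongr)
    have h2 : t⁻¹ ≤ s⁻¹ := by gcongr
    simp only
    linarith
  · refine tendsto_atTop_mono' _ ?_ tendsto_inv_nhdsGT_zero
    filter_upwards [self_mem_nhdsWithin] with t ht
    have := (hb0 t).trans (havg t ht)
    have := abs_nonneg m
    linarith
  · intro t ht
    have h1 := havg t ht
    have h2 := hb0 t
    have h3 : 0 < t⁻¹ := inv_pos.2 ht
    have h4 := le_abs_self m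
    exact ⟨by linarith, hmono t _ _ (by linarith [abs_nonneg m]) (hbP t ht)⟩

/-! ### Stress laws -/

/-- The consequences of the hypotheses on `σ` that the evolution uses. All of them concern the
values of `σ` on `(0, ∞)` only. -/
structure Admissible (σ : ℝ → ℝ) : Prop where
  lip : ∀ a b, 0 < a → ∃ L : NNReal, LipschitzOnWith L σ (Icc a b)
  /-- `σ + L id` is nondecreasing. -/
  one_sided : ∃ L, 0 ≤ L ∧ ∀ a b, 0 < a → a ≤ b → σ a - σ b ≤ L * (b - a)
  /-- Small arguments are points where `σ` lies below all its later values. -/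
  low : ∀ M, ∃ η, 0 < η ∧ ∀ y, 0 < y → y ≤ η → σ y ≤ M ∧ ∀ r, y ≤ r → σ y ≤ σ r
  /-- There are arbitrarily large record points of `σ`. -/
  high : ∀ M, ∃ b, M ≤ b ∧ 0 < b ∧ ∀ r, 0 < r → r ≤ b → σ r ≤ σ b
  top : ∃ R, 0 < R ∧ MonotoneOn σ (Ici R) ∧ 0 < σ R ∧
    IntegrableOn (fun z => 1 / σ z) (Ioi R)

lemma H1.lipschitzOnWith_Icc {σ : ℝ → ℝ} (h1 : H1 σ) {a : ℝ} (b : ℝ) (ha : 0 < a) :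
    ∃ L : NNReal, LipschitzOnWith L σ (Icc a b) := by
  have hC : 1 < 1 + |b| + 1 / a := by
    have : 0 < 1 / a := by positivity
    have := abs_nonneg b
    linarith
  obtain ⟨L, hL⟩ := h1 _ hC
  refine ⟨L, hL.mono (Icc_subset_Icc ?_ ?_)⟩
  · rw [div_le_iff₀ (by linarith)]
    have h2 : a * (1 / a) = 1 := by field_simp
    have h3 : 0 ≤ a * |b| := by positivity
    nlinarith
  · have := le_abs_self b
    have : 0 < 1 / a := by positivity
    linarith

lemma H1.continuousOn {σ : ℝ → ℝ} (h1 : H1 σ) : ContinuousOn σ (Ioi 0) := by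
  intro p hp
  have hp' : (0 : ℝ) < p := hp
  obtain ⟨L, hL⟩ := h1.lipschitzOnWith_Icc (p + 1) (half_pos hp')
  exact (hL.continuousOn.continuousAt
    (Icc_mem_nhds (by linarith) (by linarith))).continuousWithinAt

/-- A locally Lipschitz function is the integral of its derivative, so it is monotone where the
derivative is nonnegative almost everywhere. -/
lemma L1.exists_monotoneOn {σ : ℝ → ℝ} (l1 : L1 σ) (h1 : H1 σ) :
    ∃ θ, 0 < θ ∧ MonotoneOn σ (Ioo 0 θ) := by
  obtain ⟨α, hα, θ, hθ, hd⟩ := l1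
  refine ⟨θ, hθ, fun a ha b hb hab => ?_⟩
  obtain ⟨L, hL⟩ := h1.lipschitzOnWith_Icc b ha.1
  rw [← uIcc_of_le hab] at hL
  have := hL.absolutelyContinuousOnInterval.integral_deriv_eq_sub
  have hnn : 0 ≤ ∫ x in a..b, deriv σ x := by
    apply intervalIntegral.integral_nonneg_of_ae_restrict hab
    have hsub : Icc a b ⊆ Ioo 0 θ := fun r hr => ⟨ha.1.trans_le hr.1, hr.2.trans_lt hb.2⟩
    filter_upwards [ae_restrict_of_ae_restrict_of_subset hsub hd] with r hr
    exact hα.le.trans hr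
  linarith

lemma U1.exists_monotoneOn {σ : ℝ → ℝ} (u1 : U1 σ) (h1 : H1 σ) :
    ∃ R, 0 < R ∧ MonotoneOn σ (Ioi R) := by
  obtain ⟨R, hR, hconv⟩ := u1
  refine ⟨R, hR, ?_⟩
  have hcont := h1.continuousOn
  have hd : ∀ p, 0 < p → HasDerivAt (storedEnergy σ) (σ p) p := by
    intro p hp
    apply intervalIntegral.integral_hasDerivAt_right
    · apply ContinuousOn.intervalIntegrable
      exact hcont.mono fun r hr => (lt_min one_pos hp).trans_le hr.1
    · exact hcont.stronglyMeasurableAtFilter isOpen_Ioi p hp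
    · exact hcont.continuousAt (Ioi_mem_nhds hp)
  have hpos : ∀ p ∈ Ioi R, 0 < p := fun p hp => hR.trans hp
  have := hconv.convexOn.monotoneOn_deriv fun p hp => (hd p (hpos p hp)).differentiableAt
  intro a ha b hb hab
  have := this ha hb hab
  rwa [(hd a (hpos a ha)).deriv, (hd b (hpos b hb)).deriv] at this

/-- `σ` is monotone near infinity, and `1 / σ` is integrable there. -/
lemma U2.exists_top {σ : ℝ → ℝ} (u2 : U2 σ) (u1 : U1 σ) (h1 : H1 σ) :
    ∃ R, 0 < R ∧ MonotoneOn σ (Ici R) ∧ 0 < σ R ∧ IntegrableOn (fun z => 1 / σ z) (Ioi R) := by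
  obtain ⟨R₁, hR₁, hmono⟩ := u1.exists_monotoneOn h1
  obtain ⟨hev, pPlus, -, hint⟩ := u2
  obtain ⟨R, hσR, hRR₁, hRp⟩ := (hev.and ((eventually_gt_atTop R₁).and
    (eventually_gt_atTop (pPlus + 1)))).exists
  exact ⟨R, hR₁.trans hRR₁, hmono.mono fun r hr => hRR₁.trans_le hr, hσR,
    hint.mono_set (Ioi_subset_Ioi hRp.le)⟩

/-- Integrability of `1 / σ` forces `σ` to be unbounded. -/
lemma exists_ge_of_top {σ : ℝ → ℝ} {R : ℝ} (hmono : MonotoneOn σ (Ici R)) (hσR : 0 < σ R)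
    (hint : IntegrableOn (fun z => 1 / σ z) (Ioi R)) (C M : ℝ) :
    ∃ b, M ≤ b ∧ R ≤ b ∧ C ≤ σ b := by
  by_contra! h
  set K := max M R
  have hlt : ∀ r, K ≤ r → σ r < C := fun r hr =>
    h r ((le_max_left _ _).trans hr) ((le_max_right _ _).trans hr)
  have hpos : ∀ r, K ≤ r → 0 < σ r := fun r hr =>
    hσR.trans_le (hmono self_mem_Ici ((le_max_right _ _).trans hr) ((le_max_right _ _).trans hr))
  have hC : 0 < C := (hpos K le_rfl).trans (hlt K le_rfl)
  have hc : IntegrableOn (fun _ : ℝ => 1 / C) (Ioi K) := by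
    refine (hint.mono_set (Ioi_subset_Ioi (le_max_right M R))).mono'
      aestronglyMeasurable_const ?_
    filter_upwards [ae_restrict_mem measurableSet_Ioi] with r hr
    have hr' : K ≤ r := le_of_lt hr
    rw [Real.norm_of_nonneg (by positivity)]
    exact one_div_le_one_div_of_le (hpos r hr') (hlt r hr').le
  rw [integrableOn_const_iff (by simp)] at hc
  rcases hc with hc | hc
  · simp [hC.ne'] at hc
  · simp at hc

/-- The hypotheses of the evolution problem give an admissible stress law. -/
lemma admissible_of_hypotheses {σ : ℝ → ℝ} (h1 : H1 σ) (h2 : H2 σ) (l1 : L1 σ) (u1 : U1 σ)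
    (u2 : U2 σ) : Admissible σ := by
  obtain ⟨θ, hθ, hmono0⟩ := l1.exists_monotoneOn h1
  obtain ⟨R, hR, hmono, hσR, hint⟩ := u2.exists_top u1 h1
  have hcont := h1.continuousOn
  have hlow : ∀ M, ∃ η, 0 < η ∧ ∀ y, 0 < y → y ≤ η → σ y ≤ M ∧ ∀ r, y ≤ r → σ y ≤ σ r := by
    intro M
    -- a lower bound of `σ` away from `0`
    obtain ⟨m, hm⟩ : ∃ m, ∀ r, θ / 2 ≤ r → m ≤ σ r := by
      have hcpt : IsCompact (σ '' Icc (θ / 2) (max R (θ / 2))) :=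
        isCompact_Icc.image_of_continuousOn
          (hcont.mono fun r hr => lt_of_lt_of_le (half_pos hθ) hr.1)
      obtain ⟨m, hm⟩ := hcpt.bddBelow
      refine ⟨m, fun r hr => ?_⟩
      rcases le_total r (max R (θ / 2)) with hrR | hrR
      · exact hm ⟨r, ⟨hr, hrR⟩, rfl⟩
      · exact (hm ⟨_, ⟨le_max_right _ _, le_rfl⟩, rfl⟩).trans
          (hmono (le_max_left R (θ / 2)) ((le_max_left R (θ / 2)).trans hrR) hrR)
    have hev := h2.eventually (eventually_le_atBot (min M m))
    rw [eventually_nhdsWithin_iff, Metric.eventually_nhds_iff] at hev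
    obtain ⟨ε, hε, hball⟩ := hev
    refine ⟨min (ε / 2) (θ / 2), by positivity, fun y hy hyη => ?_⟩
    have hyε := hyη.trans (min_le_left _ _)
    have hyθ := hyη.trans (min_le_right _ _)
    have hσy : σ y ≤ min M m := by
      apply hball _ hy
      rw [Real.dist_eq, sub_zero, abs_of_pos hy]
      linarith
    refine ⟨hσy.trans (min_le_left _ _), fun r hyr => ?_⟩
    rcases le_total (θ / 2) r with hr | hr
    · exact (hσy.trans (min_le_right _ _)).trans (hm r hr)
    · exact hmono0 ⟨hy, by linarith⟩ ⟨by linarith, by linarith⟩ hyr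
  refine ⟨fun a b ha => h1.lipschitzOnWith_Icc b ha, ?_, hlow, ?_, R, hR, hmono, hσR, hint⟩
  · -- monotone near `0`, Lipschitz on `[A, B]`, monotone near infinity
    set A := θ / 2 with hA
    have hA0 : 0 < A := half_pos hθ
    set B := max R A with hB
    have hAB : A ≤ B := le_max_right _ _
    obtain ⟨L, hL⟩ := h1.lipschitzOnWith_Icc B hA0
    refine ⟨L, L.2, fun a b ha hab => ?_⟩
    have hL0 : (0 : ℝ) ≤ L := L.2
    have hlow' : ∀ x y, 0 < x → x ≤ y → y ≤ A → σ x ≤ σ y := fun x y hx hxy hy =>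
      hmono0 ⟨hx, by linarith⟩ ⟨by linarith, by linarith⟩ hxy
    have htop' : ∀ x y, B ≤ x → x ≤ y → σ x ≤ σ y := fun x y hx hxy =>
      hmono ((le_max_left R A).trans hx) (((le_max_left R A).trans hx).trans hxy) hxy
    have hmid : ∀ x y, A ≤ x → x ≤ y → y ≤ B → σ x - σ y ≤ L * (y - x) := by
      intro x y hx hxy hy
      have := hL.dist_le_mul x ⟨hx, hxy.trans hy⟩ y ⟨hx.trans hxy, hy⟩
      rw [Real.dist_eq, Real.dist_eq, abs_sub_comm x y, abs_of_nonneg (sub_nonneg.2 hxy)] at this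
      exact (le_abs_self _).trans this
    have hleB : ∀ y, a ≤ y → y ≤ B → σ a - σ y ≤ L * (y - a) := by
      intro y hay hy
      rcases le_total A a with h | h
      · exact hmid a y h hay hy
      rcases le_total y A with h' | h'
      · have := hlow' a y ha hay h'
        have := mul_nonneg hL0 (sub_nonneg.2 hay)
        linarith
      · have := hlow' a A ha h le_rfl
        have := hmid A y le_rfl h' hy
        have := mul_nonneg hL0 (sub_nonneg.2 h)
        linarith
    rcases le_total b B with hb | hb
    · exact hleB b hab hb
    rcases le_total B a with h | h
    · have := htop' a b h hab
      have := mul_nonneg hL0 (sub_nonneg.2 hab)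
      linarith
    · have := hleB B h le_rfl
      have := htop' B b le_rfl hb
      have := mul_nonneg hL0 (sub_nonneg.2 hb)
      linarith
  · intro M
    obtain ⟨η, hη, hη'⟩ := hlow 0
    have hcpt : IsCompact (σ '' Icc η (max R η)) :=
      isCompact_Icc.image_of_continuousOn (hcont.mono fun r hr => lt_of_lt_of_le hη hr.1)
    obtain ⟨C, hC⟩ := hcpt.bddAbove
    obtain ⟨b, hMb, hRb, hCb⟩ := exists_ge_of_top hmono hσR hint C M
    refine ⟨b, hMb, hR.trans_le hRb, fun r hr hrb => ?_⟩
    rcases le_total R r with hRr | hRr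
    · exact hmono hRr hRb hrb
    · refine le_trans ?_ hCb
      rcases le_total r η with h | h
      · exact ((hη' r hr h).2 η h).trans (hC ⟨η, ⟨le_rfl, le_max_right _ _⟩, rfl⟩)
      · exact hC ⟨r, ⟨h, hRr.trans (le_max_left _ _)⟩, rfl⟩

namespace Admissible

variable {σ : ℝ → ℝ}

lemma congr {σ' : ℝ → ℝ} (hσ : Admissible σ) (h : EqOn σ' σ (Ioi 0)) : Admissible σ' where
  lip a b ha := by
    obtain ⟨L, hL⟩ := hσ.lip a b ha
    refine ⟨L, fun x hx y hy => ?_⟩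
    rw [h (ha.trans_le hx.1), h (ha.trans_le hy.1)]
    exact hL hx hy
  one_sided := by
    obtain ⟨L, hL, H⟩ := hσ.one_sided
    refine ⟨L, hL, fun a b ha hab => ?_⟩
    rw [h ha, h (ha.trans_le hab)]
    exact H a b ha hab
  low M := by
    obtain ⟨η, hη, H⟩ := hσ.low M
    refine ⟨η, hη, fun y hy hyη => ?_⟩
    rw [h hy]
    refine ⟨(H y hy hyη).1, fun r hr => ?_⟩
    rw [h (hy.trans_le hr)]
    exact (H y hy hyη).2 r hr
  high M := by
    obtain ⟨b, hMb, hb, H⟩ := hσ.high M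
    refine ⟨b, hMb, hb, fun r hr hrb => ?_⟩
    rw [h hr, h hb]
    exact H r hr hrb
  top := by
    obtain ⟨R, hR, hmono, hpos, hint⟩ := hσ.top
    refine ⟨R, hR, ?_, by rwa [h hR], ?_⟩
    · intro x hx y hy hxy
      rw [h (hR.trans_le hx), h (hR.trans_le hy)]
      exact hmono hx hy hxy
    · refine hint.congr_fun (fun x hx => ?_) measurableSet_Ioi
      simp only [h (hR.trans hx)]

lemma continuousOn (hσ : Admissible σ) : ContinuousOn σ (Ioi 0) := by
  intro p hp
  have hp' : (0 : ℝ) < p := hp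
  obtain ⟨L, hL⟩ := hσ.lip _ (p + 1) (half_pos hp')
  exact (hL.continuousOn.continuousAt
    (Icc_mem_nhds (by linarith) (by linarith))).continuousWithinAt

/-- Coming down from infinity: a trajectory with `z' ≤ M - σ(z)` wherever `z` is large lies below
a bound that depends on the elapsed time but not on the initial value. The trajectory needs at most
the time `4 ∫ dz / σ(z)`, taken over `[2 ^ (k - 1), 2 ^ k]`, to fall from `2 ^ (k + 1)`
to `2 ^ k`, and these times have a finite sum. -/
lemma exists_bound_of_descent (hσ : Admissible σ) :
    ∃ R, 0 < R ∧ MonotoneOn σ (Ici R) ∧ ∀ M τ, 0 < τ → ∃ B, ∀ (s t : ℝ) (z h : ℝ → ℝ),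
      s + τ ≤ t → IsPrimitiveOn z h s t →
      (∀ᵐ r ∂volume.restrict (Icc s t), R ≤ z r → h r ≤ M - σ (z r)) → z t ≤ B := by
  obtain ⟨R, hR, hmono, hσR, hint⟩ := hσ.top
  refine ⟨R, hR, hmono, fun M τ hτ => ?_⟩
  have hpos : ∀ r, R ≤ r → 0 < σ r := fun r hr => hσR.trans_le (hmono self_mem_Ici hr hr)
  have hii : ∀ x y, R ≤ x → R ≤ y → IntervalIntegrable (fun z => 1 / σ z) volume x y := by
    intro x y hx hy
    rw [intervalIntegrable_iff]
    exact hint.mono_set fun r hr => (le_min hx hy).trans_lt hr.1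
  set D : ℝ → ℝ := fun x => ∫ z in R..x, 1 / σ z with hD
  have hDsub : ∀ x y, R ≤ x → R ≤ y → D y - D x = ∫ z in x..y, 1 / σ z := fun x y hx hy =>
    intervalIntegral.integral_interval_sub_left (hii _ _ le_rfl hy) (hii _ _ le_rfl hx)
  have hDmono : ∀ x y, R ≤ x → x ≤ y → D x ≤ D y := by
    intro x y hx hxy
    rw [← sub_nonneg, hDsub x y hx (hx.trans hxy)]
    exact intervalIntegral.integral_nonneg hxy fun r hr =>
      (one_div_pos.2 (hpos r (hx.trans hr.1))).le
  have hDlim : Tendsto D atTop (𝓝 (∫ z in Ioi R, 1 / σ z)) :=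
    intervalIntegral_tendsto_integral_Ioi R hint tendsto_id
  set I := ∫ z in Ioi R, 1 / σ z with hI
  have hDle : ∀ x, R ≤ x → D x ≤ I := fun x hx => by
    refine ge_of_tendsto hDlim ?_
    filter_upwards [eventually_ge_atTop x] with y hy using hDmono x y hx hy
  obtain ⟨b, -, hRb, hσb⟩ := exists_ge_of_top hmono hσR hint (2 * M) R
  have hpow : Tendsto (fun k : ℕ => (2 : ℝ) ^ k) atTop atTop :=
    tendsto_pow_atTop_atTop_of_one_lt one_lt_two
  obtain ⟨k, hDk, hbk⟩ := (((hDlim.comp hpow).eventually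
    (lt_mem_nhds (show I - τ / 4 < I by linarith))).and (hpow.eventually_ge_atTop b)).exists
  have hRk : ∀ j, R ≤ (2 : ℝ) ^ (k + j) := fun j =>
    (hRb.trans hbk).trans (pow_le_pow_right₀ one_le_two (Nat.le_add_right _ _))
  have hσk : ∀ j, 2 * M ≤ σ (2 ^ (k + j)) := fun j =>
    hσb.trans (hmono hRb (hRk j) (hbk.trans (pow_le_pow_right₀ one_le_two (Nat.le_add_right _ _))))
  have claim : ∀ (j : ℕ) (s t : ℝ) (z h : ℝ → ℝ),
      z s ≤ 2 ^ (k + j + 1) → s + 4 * (D (2 ^ (k + j)) - D (2 ^ k)) ≤ t →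
      IsPrimitiveOn z h s t →
      (∀ᵐ r ∂volume.restrict (Icc s t), R ≤ z r → h r ≤ M - σ (z r)) → z t ≤ 2 ^ (k + 1) := by
    intro j
    induction j with
    | zero =>
      intro s t z h hzs hst hz hle
      refine hz.le_of_barrier (by simpa using hst) hzs ?_
      filter_upwards [hle] with r hr hzr
      have hRz : R ≤ z r := (hRk 1).trans hzr.le
      have h1 := hmono (hRk 1) hRz hzr.le
      have h2 := hσk 1
      have h3 := hpos _ (hRk 1)
      have h4 := hr hRz
      linarith
    | succ j ih =>
      intro s t z h hzs hst hz hle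
      set A : ℝ := 2 ^ (k + j + 1) with hA
      have hRA : R ≤ A := hRk (j + 1)
      have hA0 : 0 < A := by positivity
      have hhalf : (2 : ℝ) ^ (k + j) = A / 2 := by rw [hA, pow_succ]; ring
      have hσA : 2 * M ≤ σ A := hσk (j + 1)
      have hσA0 : 0 < σ A := hpos A hRA
      set d := 4 * (D A - D (2 ^ (k + j))) with hd
      -- the integrand is at least `1 / σ A` on `[A / 2, A]`
      have hdA : A ≤ σ A / 2 * d := by
        have h1 : ∫ _ in (A / 2)..A, 1 / σ A ≤ ∫ z in (A / 2)..A, 1 / σ z := by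
          apply intervalIntegral.integral_mono_on (by linarith) intervalIntegrable_const
            (hii _ _ (hhalf ▸ hRk j) hRA)
          intro r hr
          have hRr : R ≤ r := (hhalf ▸ hRk j : R ≤ A / 2).trans hr.1
          exact one_div_le_one_div_of_le (hpos r hRr) (hmono hRr hRA hr.2)
        rw [intervalIntegral.integral_const, smul_eq_mul, ← hhalf, ← hDsub _ _ (hRk j) hRA,
          hhalf] at h1
        rw [hd, hhalf]
        calc A = σ A / 2 * (4 * ((A - A / 2) * (1 / σ A))) := by field_simp; ring
          _ ≤ _ := by gcongr
      have hd0 : 0 ≤ d := by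
        have := hDmono (2 ^ (k + j)) A (hRk j) (by linarith)
        simp only [hd]
        linarith
      have hDj := hDmono (2 ^ k) (2 ^ (k + j)) (hRk 0)
        (pow_le_pow_right₀ one_le_two (Nat.le_add_right _ _))
      have hst' : s + d + 4 * (D (2 ^ (k + j)) - D (2 ^ k)) ≤ t := by
        have : (2 : ℝ) ^ (k + (j + 1)) = A := rfl
        rw [this] at hst
        simp only [hd]
        linarith
      refine ih (s + d) t z h ?_ hst' (hz.mono (by linarith) le_rfl)
        (ae_restrict_of_ae_restrict_of_subset (Icc_subset_Icc (by linarith) le_rfl) hle)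
      have hdesc := (hz.mono (b := s + d) le_rfl (by linarith)).le_max_of_descent (A := A)
        (c := σ A / 2) (by linarith) (by positivity) (by
          filter_upwards [ae_restrict_of_ae_restrict_of_subset
            (Icc_subset_Icc le_rfl (by linarith)) hle] with r hr hzr
          have h1 := hr (hRA.trans hzr.le)
          have h2 := hmono hRA (hRA.trans hzr.le) hzr.le
          linarith)
      refine hdesc.trans (max_le le_rfl ?_)
      have : (2 : ℝ) ^ (k + (j + 1) + 1) = 2 * A := by rw [hA]; ring
      rw [this] at hzs
      have : s + d - s = d := by ring
      rw [this]
      linarith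
  refine ⟨2 ^ (k + 1), fun s t z h hst hz hle => ?_⟩
  obtain ⟨j, hj⟩ := (hpow.eventually_ge_atTop (z s)).exists
  refine claim j s t z h (hj.trans (pow_le_pow_right₀ one_le_two (by omega))) ?_ hz hle
  have h1 := hDle _ (hRk j)
  simp only [Function.comp_apply] at hDk
  linarith

end Admissible

/-! ### Flows -/

/-- A family of trajectories `r ↦ f x r`, `r ∈ [s, t]`, of the scalar equations `p' = S - σ(p)`
that are coupled by `S r = ∫ σ(f x r) dx`. The index `x` runs over all of `ℝ`, so that exceptional
indices are excluded and trajectories with index outside `(0, 1)` may serve for comparison. -/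
structure Flow (σ : ℝ → ℝ) (s t : ℝ) (f : ℝ → ℝ → ℝ) (S : ℝ → ℝ) : Prop where
  meas : ∀ r, Measurable fun x => f x r
  cont : ∀ x, Continuous (f x)
  pos : ∀ x, ∀ᵐ r ∂volume.restrict (Icc s t), 0 < f x r
  nonneg : ∀ x, ∀ r ∈ Icc s t, 0 ≤ f x r
  prim : ∀ x, IsPrimitiveOn (f x) (fun r => S r - σ (f x r)) s t
  stress : ∀ᵐ r ∂volume.restrict (Icc s t),
    Integrable (fun x => σ (f x r)) unitMeasure ∧ S r = ∫ x, σ (f x r) ∂unitMeasure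

namespace Flow

variable {σ : ℝ → ℝ} {s t : ℝ} {f g : ℝ → ℝ → ℝ} {S S' : ℝ → ℝ}

lemma mono (hf : Flow σ s t f S) {a b : ℝ} (ha : s ≤ a) (hb : b ≤ t) : Flow σ a b f S where
  meas := hf.meas
  cont := hf.cont
  pos x := ae_restrict_of_ae_restrict_of_subset (Icc_subset_Icc ha hb) (hf.pos x)
  nonneg x r hr := hf.nonneg x r (Icc_subset_Icc ha hb hr)
  prim x := (hf.prim x).mono ha hb
  stress := ae_restrict_of_ae_restrict_of_subset (Icc_subset_Icc ha hb) hf.stress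

lemma measurable_uncurry (hf : Flow σ s t f S) : Measurable fun z : ℝ × ℝ => f z.2 z.1 :=
  measurable_uncurry_of_continuous_of_measurable (u := fun r x => f x r) hf.cont hf.meas

lemma ae_ae_pos (hf : Flow σ s t f S) :
    ∀ᵐ r ∂volume.restrict (Icc s t), ∀ᵐ x ∂unitMeasure, 0 < f x r :=
  (Measure.ae_ae_comm (p := fun r x => 0 < f x r)
    (measurableSet_lt measurable_const hf.measurable_uncurry)).2 (ae_of_all _ hf.pos)

lemma integrable_of_le (hf : Flow σ s t f S) {E r : ℝ} (hr : r ∈ Icc s t)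
    (hE : ∀ x, f x r ≤ E) : Integrable (fun x => f x r) unitMeasure := by
  refine Integrable.of_bound (hf.meas r).aestronglyMeasurable E (ae_of_all _ fun x => ?_)
  rw [Real.norm_of_nonneg (hf.nonneg x r hr)]
  exact hE x

/-- Two trajectories with the common forcing `S` keep their order. -/
lemma le_of_le (hf : Flow σ s t f S) (hσ : Admissible σ) (hst : s ≤ t) {x y : ℝ}
    (hxy : f x s ≤ f y s) : f x t ≤ f y t := by
  obtain ⟨L, hL, hone⟩ := hσ.one_sided
  have := ((hf.prim x).sub (hf.prim y)).nonpos hst hL (by linarith) (by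
    filter_upwards [hf.pos y] with r hy hlt
    have := hone (f y r) (f x r) hy (by linarith)
    linarith)
  linarith

/-- A flow that contains a trajectory below `K` is bounded above at positive elapsed times,
independently of its initial values. -/
lemma exists_upper_bound (hσ : Admissible σ) (K τ : ℝ) (hτ : 0 < τ) :
    ∃ B, ∀ (s t : ℝ) (f : ℝ → ℝ → ℝ) (S : ℝ → ℝ), Flow σ s t f S → s + τ ≤ t →
      ∀ y, (∀ r ∈ Icc s t, f y r ≤ K) → ∀ x, f x t ≤ B := by
  obtain ⟨R, hR, hmono, hdesc⟩ := hσ.exists_bound_of_descent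
  obtain ⟨b, hKb, hb, hrec⟩ := hσ.high K
  obtain ⟨B, hB⟩ := hdesc (σ b) τ hτ
  refine ⟨B + K, fun s t f S hf hst y hy x => ?_⟩
  have hst' : s ≤ t := by linarith
  have := hB s t _ _ hst ((hf.prim x).sub (hf.prim y)) (by
    filter_upwards [hf.pos y, ae_restrict_mem measurableSet_Icc] with r hyr hr hRz
    have h1 := hrec (f y r) hyr ((hy r hr).trans hKb)
    have h2 := hmono hRz (show R ≤ f x r by linarith) (by linarith)
    linarith)
  linarith [hy t ⟨hst', le_rfl⟩]

/-- The lowest trajectory rises at rate at least `m / (2 E)` as long as it is small: then its stress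
lies below all the others, and strictly so on the set where the flow exceeds half its mean. -/
lemma exists_lower_bound (hσ : Admissible σ) {m E : ℝ} (hm : 0 < m) (hE : 0 < E) :
    ∃ η, 0 < η ∧ ∀ (s t : ℝ) (f : ℝ → ℝ → ℝ) (S : ℝ → ℝ) (x₀ : ℝ), Flow σ s t f S → s ≤ t →
      (∀ x, f x₀ s ≤ f x s) → (∀ x, ∀ r ∈ Icc s t, f x r ≤ E) →
      (∀ r ∈ Icc s t, ∫ x, f x r ∂unitMeasure = m) →
      ∀ x, min η (m / (2 * E) * (t - s)) ≤ f x t := by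
  obtain ⟨η₀, hη₀, hlow₀⟩ := hσ.low 0
  set y₀ := min η₀ (m / 2) with hy₀
  have hy₀pos : 0 < y₀ := lt_min hη₀ (by linarith)
  obtain ⟨η, hη, hlow⟩ := hσ.low (σ y₀ - 1)
  refine ⟨η, hη, fun s t f S x₀ hf hst hx₀ hfE hmean x => ?_⟩
  have hx₀r : ∀ r ∈ Icc s t, ∀ x, f x₀ r ≤ f x r := fun r hr x =>
    (hf.mono le_rfl hr.2).le_of_le hσ hr.1 (hx₀ x)
  have hc : 0 ≤ m / (2 * E) := by positivity
  have key := (hf.prim x₀).neg.le_max_of_descent (A := -η) (c := m / (2 * E)) hst hc (by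
    filter_upwards [hf.pos x₀, hf.stress, ae_restrict_mem measurableSet_Icc]
      with r hpos hS hr hlt
    have hyη : f x₀ r ≤ η := by linarith
    obtain ⟨h1, h2⟩ := hlow _ hpos hyη
    have hpt : ∀ x, (f x r - m / 2) / E ≤ σ (f x r) - σ (f x₀ r) := by
      intro x
      rcases le_total (m / 2) (f x r) with h | h
      · have h3 := (hlow₀ y₀ hy₀pos (min_le_left _ _)).2 (f x r) ((min_le_right _ _).trans h)
        have h4 : (f x r - m / 2) / E ≤ 1 := by
          rw [div_le_one hE]
          linarith [hfE x r hr]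
        linarith
      · have h3 := h2 (f x r) (hx₀r r hr x)
        have h4 : (f x r - m / 2) / E ≤ 0 := div_nonpos_of_nonpos_of_nonneg (by linarith) hE.le
        linarith
    have hfi := hf.integrable_of_le hr (fun x => hfE x r hr)
    have hmono := integral_mono (μ := unitMeasure) ((hfi.sub (integrable_const (m / 2))).div_const E)
      (hS.1.sub (integrable_const (σ (f x₀ r)))) hpt
    simp only [Pi.sub_apply] at hmono
    rw [integral_div, integral_sub hfi (integrable_const _),
      integral_sub hS.1 (integrable_const _), hmean r hr, ← hS.2] at hmono
    simp only [integral_const, probReal_univ, smul_eq_mul, one_mul] at hmono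
    have : m / (2 * E) = (m - m / 2) / E := by field_simp; ring
    linarith)
  refine le_trans ?_ (hx₀r t ⟨hst, le_rfl⟩ x)
  have h0 := hf.nonneg x₀ s ⟨le_rfl, hst⟩
  rcases le_max_iff.1 key with h | h
  · exact (min_le_left _ _).trans (by linarith)
  · exact (min_le_right _ _).trans (by linarith)

/-- A flow with bounded mean contains a bounded trajectory. -/
lemma exists_trajectory_le (hf : Flow σ s t f S) (hσ : Admissible σ) {K : ℝ} (hK : 0 < K)
    (hfi : ∀ r ∈ Icc s t, Integrable (fun x => f x r) unitMeasure)
    (hmean : ∀ r ∈ Icc s t, ∫ x, f x r ∂unitMeasure ≤ K) :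
    ∃ y, ∀ r ∈ Icc s t, f y r ≤ 2 * K := by
  obtain ⟨y, hy⟩ := exists_measure_lt_lt unitMeasure (hf.meas s) (δ := 1 / 2) (by simp)
  refine ⟨y, fun r hr => ?_⟩
  by_contra! hlt
  -- more than half of the trajectories start, hence stay, above the trajectory of `y`
  have hsub : {x | f x s < f y s}ᶜ ⊆ {x | 2 * K < f x r} := by
    intro x hx
    exact hlt.trans_le ((hf.mono le_rfl hr.2).le_of_le hσ hr.1 (not_lt.1 hx))
  have hmeas : MeasurableSet {x | f x s < f y s} := measurableSet_lt (hf.meas s) measurable_const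
  have hhalf : unitMeasure.real {x | f x s < f y s} < 1 / 2 := by
    have := (ENNReal.toReal_lt_toReal (measure_ne_top _ _) (by simp)).2 hy
    simpa [Measure.real] using this
  have h1 : 1 / 2 < unitMeasure.real {x | 2 * K < f x r} := by
    have h2 := measureReal_mono (μ := unitMeasure) hsub
    rw [probReal_compl_eq_one_sub hmeas] at h2
    linarith
  have h3 := mul_meas_ge_le_integral_of_nonneg (μ := unitMeasure)
    (ae_of_all _ fun x => hf.nonneg x r hr) (hfi r hr) (2 * K)
  have h4 : unitMeasure.real {x | 2 * K < f x r} ≤ unitMeasure.real {x | 2 * K ≤ f x r} :=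
    measureReal_mono fun x (hx : 2 * K < f x r) => hx.le
  have h5 := hmean r hr
  nlinarith

/-- A bounded flow with mean at least `m` contains a trajectory above `m / 2`. -/
lemma exists_le_trajectory (hf : Flow σ s t f S) (hσ : Admissible σ) {m E : ℝ} (hm : 0 < m)
    (hE : 0 < E) (hfE : ∀ x, ∀ r ∈ Icc s t, f x r ≤ E)
    (hmean : ∀ r ∈ Icc s t, m ≤ ∫ x, f x r ∂unitMeasure) :
    ∃ y, ∀ r ∈ Icc s t, m / 2 ≤ f y r := by
  obtain ⟨y, hy⟩ := exists_measure_lt_lt unitMeasure (hf.meas s).neg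
    (δ := ENNReal.ofReal (m / (2 * E))) (by simp; positivity)
  refine ⟨y, fun r hr => ?_⟩
  by_contra! hlt
  have hmeas : MeasurableSet {x | (-fun x => f x s) x < (-fun x => f x s) y} :=
    measurableSet_lt (hf.meas s).neg measurable_const
  set A := {x | (-fun x => f x s) x < (-fun x => f x s) y} with hA
  have hreal : unitMeasure.real A < m / (2 * E) := by
    have := (ENNReal.toReal_lt_toReal (measure_ne_top _ _) (by simp)).2 hy
    rwa [ENNReal.toReal_ofReal (by positivity)] at this
  have hpt : ∀ x, f x r ≤ m / 2 + A.indicator (fun _ => E) x := by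
    intro x
    by_cases hx : x ∈ A
    · rw [indicator_of_mem hx]
      linarith [hfE x r hr]
    · rw [indicator_of_notMem hx]
      have : f x s ≤ f y s := by
        simp only [hA, mem_ofPred_eq, Pi.neg_apply, neg_lt_neg_iff, not_lt] at hx
        exact hx
      have := (hf.mono le_rfl hr.2).le_of_le hσ hr.1 this
      linarith
  have hind : Integrable (A.indicator fun _ => E) unitMeasure :=
    (integrable_const E).indicator hmeas
  have h1 := integral_mono (hf.integrable_of_le hr fun x => hfE x r hr)
    ((integrable_const (μ := unitMeasure) (m / 2)).add hind) hpt
  simp only [Pi.add_apply] at h1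
  rw [integral_add (integrable_const _) hind, integral_indicator_const _ hmeas] at h1
  simp only [integral_const, probReal_univ, smul_eq_mul, one_mul] at h1
  have h2 := hmean r hr
  have h3 : unitMeasure.real A * E < m / (2 * E) * E := by gcongr
  have h4 : m / (2 * E) * E = m / 2 := by field_simp
  linarith

/-- Where a single trajectory is bounded and bounded away from `0`, the mean stress `S` is
integrable in time. -/
lemma integrableOn_of_trajectory (hf : Flow σ s t f S) (hσ : Admissible σ) {y c : ℝ} (hc : 0 < c)
    (hy : ∀ r ∈ Icc s t, c ≤ f y r) : IntegrableOn S (Icc s t) := by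
  have h1 : ContinuousOn (fun r => σ (f y r)) (Icc s t) :=
    hσ.continuousOn.comp (hf.cont y).continuousOn fun r hr => hc.trans_le (hy r hr)
  refine ((hf.prim y).1.add (h1.integrableOn_Icc)).congr (ae_of_all _ fun r => ?_)
  simp

lemma integrable_stress (hf : Flow σ s t f S) (hσ : Admissible σ) (hm : Measurable σ) {E : ℝ}
    (hfE : ∀ x, ∀ r ∈ Icc s t, f x r ≤ E) (hS : IntegrableOn S (Icc s t)) :
    Integrable (fun z : ℝ × ℝ => σ (f z.2 z.1)) ((volume.restrict (Icc s t)).prod unitMeasure) := by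
  obtain ⟨b, hEb, hb, hrec⟩ := hσ.high E
  have hmeas : Measurable fun z : ℝ × ℝ => σ (f z.2 z.1) := hm.comp hf.measurable_uncurry
  have key : Integrable (fun z : ℝ × ℝ => σ b - σ (f z.2 z.1))
      ((volume.restrict (Icc s t)).prod unitMeasure) := by
    refine (integrable_prod_iff (hmeas.const_sub (σ b)).aestronglyMeasurable).2 ?_
    refine ⟨?_, ((integrable_const (σ b)).sub hS).congr ?_⟩
    · filter_upwards [hf.stress] with r hr using (integrable_const _).sub hr.1
    · filter_upwards [hf.stress, hf.ae_ae_pos, ae_restrict_mem measurableSet_Icc]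
        with r hr hpos hrI
      have : ∫ x, ‖σ b - σ (f x r)‖ ∂unitMeasure = ∫ x, (σ b - σ (f x r)) ∂unitMeasure := by
        apply integral_congr_ae
        filter_upwards [hpos] with x hx
        exact Real.norm_of_nonneg (sub_nonneg.2 (hrec _ hx ((hfE x r hrI).trans hEb)))
      simp only [this, Pi.sub_apply]
      rw [integral_sub (integrable_const _) hr.1, ← hr.2]
      simp
  refine ((integrable_const (σ b)).sub key).congr (ae_of_all _ fun z => ?_)
  simp

/-- The mean of a bounded flow with integrable mean stress is conserved. -/
lemma integral_eq (hf : Flow σ s t f S) (hσ : Admissible σ) (hm : Measurable σ) (hst : s ≤ t)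
    {E : ℝ} (hfE : ∀ x, ∀ r ∈ Icc s t, f x r ≤ E) (hS : IntegrableOn S (Icc s t)) :
    ∫ x, f x t ∂unitMeasure = ∫ x, f x s ∂unitMeasure := by
  have h1 := IsPrimitiveOn.integral_unitMeasure hf.prim
    ((hS.comp_fst unitMeasure).sub (hf.integrable_stress hσ hm hfE hS))
    (fun r hr => hf.integrable_of_le hr fun x => hfE x r hr)
  have h2 : ∀ᵐ r ∂volume.restrict (Icc s t), ∫ x, (S r - σ (f x r)) ∂unitMeasure = 0 := by
    filter_upwards [hf.stress] with r hr
    rw [integral_sub (integrable_const _) hr.1, ← hr.2]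
    simp
  have h3 := h1.2 s ⟨le_rfl, hst⟩ t ⟨hst, le_rfl⟩
  rw [intervalIntegral.integral_of_le hst, ← integral_Icc_eq_integral_Ioc,
    integral_congr_ae h2] at h3
  simpa using h3

/-- `L²` stability. As both flows have the same mean, the nonlocal terms drop out and only the
one-sided Lipschitz bound on `σ` enters. -/
lemma integral_sq_sub_le (hf : Flow σ s t f S) (hg : Flow σ s t g S') (hσ : Admissible σ)
    (hm : Measurable σ) (hst : s ≤ t) {L : ℝ} (hL : 0 ≤ L)
    (hone : ∀ a b, 0 < a → a ≤ b → σ a - σ b ≤ L * (b - a)) {E : ℝ}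
    (hfE : ∀ x, ∀ r ∈ Icc s t, f x r ≤ E) (hgE : ∀ x, ∀ r ∈ Icc s t, g x r ≤ E)
    (hS : IntegrableOn S (Icc s t)) (hS' : IntegrableOn S' (Icc s t))
    (hmean : ∀ r ∈ Icc s t, ∫ x, f x r ∂unitMeasure = ∫ x, g x r ∂unitMeasure) :
    ∫ x, (f x t - g x t) ^ 2 ∂unitMeasure ≤
      (∫ x, (f x s - g x s) ^ 2 ∂unitMeasure) * Real.exp (2 * L * (t - s)) := by
  have hbound : ∀ x, ∀ r ∈ Icc s t, ‖f x r - g x r‖ ≤ E := by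
    intro x r hr
    rw [Real.norm_eq_abs, abs_le]
    constructor <;> linarith [hf.nonneg x r hr, hg.nonneg x r hr, hfE x r hr, hgE x r hr]
  have hum : Measurable fun z : ℝ × ℝ => f z.2 z.1 - g z.2 z.1 :=
    hf.measurable_uncurry.sub hg.measurable_uncurry
  have hprim : ∀ x, IsPrimitiveOn (fun r => (f x r - g x r) ^ 2)
      (fun r => 2 * (f x r - g x r) * ((S r - σ (f x r)) - (S' r - σ (g x r)))) s t :=
    fun x => ((hf.prim x).sub (hg.prim x)).sq
  have hint : Integrable (fun z : ℝ × ℝ => 2 * (f z.2 z.1 - g z.2 z.1) *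
      ((S z.1 - σ (f z.2 z.1)) - (S' z.1 - σ (g z.2 z.1))))
      ((volume.restrict (Icc s t)).prod unitMeasure) := by
    have h1 := ((hS.comp_fst unitMeasure).sub (hf.integrable_stress hσ hm hfE hS)).sub
      ((hS'.comp_fst unitMeasure).sub (hg.integrable_stress hσ hm hgE hS'))
    refine h1.bdd_mul (c := 2 * E) (hum.const_mul 2).aestronglyMeasurable ?_
    have : ∀ᵐ z : ℝ × ℝ ∂(volume.restrict (Icc s t)).prod unitMeasure, z.1 ∈ Icc s t :=
      Measure.quasiMeasurePreserving_fst.ae (ae_restrict_mem measurableSet_Icc)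
    filter_upwards [this] with z hz
    rw [norm_mul, Real.norm_of_nonneg (by norm_num : (0 : ℝ) ≤ 2)]
    linarith [hbound z.2 z.1 hz]
  have hui : ∀ r ∈ Icc s t, Integrable (fun x => f x r - g x r) unitMeasure := fun r hr =>
    (hf.integrable_of_le hr fun x => hfE x r hr).sub (hg.integrable_of_le hr fun x => hgE x r hr)
  have hsq : ∀ r ∈ Icc s t, Integrable (fun x => (f x r - g x r) ^ 2) unitMeasure := by
    intro r hr
    simp only [pow_two]
    exact (hui r hr).bdd_mul (c := E) ((hf.meas r).sub (hg.meas r)).aestronglyMeasurable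
      (ae_of_all _ fun x => hbound x r hr)
  have h1 := IsPrimitiveOn.integral_unitMeasure hprim hint hsq
  have h2 := h1.le_gronwall (A := ∫ x, (f x s - g x s) ^ 2 ∂unitMeasure) (L := 2 * L) (η := 0) hst
    (by positivity) (integral_nonneg fun x => sq_nonneg _) le_rfl le_rfl (by
    filter_upwards [hf.stress, hg.stress, hf.ae_ae_pos, hg.ae_ae_pos,
      ae_restrict_mem measurableSet_Icc] with r hSf hSg hfpos hgpos hr _
    have hσi : Integrable (fun x => 2 * (f x r - g x r) * (σ (g x r) - σ (f x r)))
        unitMeasure := by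
      refine (hSg.1.sub hSf.1).bdd_mul (c := 2 * E)
        (((hf.meas r).sub (hg.meas r)).const_mul 2).aestronglyMeasurable
        (ae_of_all _ fun x => ?_)
      rw [norm_mul, Real.norm_of_nonneg (by norm_num : (0 : ℝ) ≤ 2)]
      linarith [hbound x r hr]
    have hsplit : ∀ x, 2 * (f x r - g x r) * ((S r - σ (f x r)) - (S' r - σ (g x r))) =
        2 * (S r - S' r) * (f x r - g x r) +
          2 * (f x r - g x r) * (σ (g x r) - σ (f x r)) := fun x => by ring
    have hzero : ∫ x, (f x r - g x r) ∂unitMeasure = 0 := by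
      rw [integral_sub (hf.integrable_of_le hr fun x => hfE x r hr)
        (hg.integrable_of_le hr fun x => hgE x r hr), hmean r hr, sub_self]
    simp only [hsplit]
    rw [integral_add ((hui r hr).const_mul _) hσi, integral_const_mul, hzero, mul_zero, zero_add,
      add_zero, ← integral_const_mul]
    apply integral_mono_ae hσi ((hsq r hr).const_mul _)
    filter_upwards [hfpos, hgpos] with x hfx hgx
    rcases le_total (f x r) (g x r) with h | h
    · have := hone _ _ hfx h
      nlinarith
    · have := hone _ _ hgx h
      nlinarith)
  simpa using h2

end Flow

/-! ### Solutions as flows -/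

lemma measurable_indicator_Ioi {σ : ℝ → ℝ} (hσ : Admissible σ) :
    Measurable ((Ioi 0).indicator σ) := by
  classical
  rw [← Set.piecewise_eq_indicator]
  exact hσ.continuousOn.measurable_piecewise continuousOn_const measurableSet_Ioi

lemma norm_sq_eq_integral (w : Lp ℝ 2 unitMeasure) :
    ‖w‖ ^ 2 = ∫ x, (w x) ^ 2 ∂unitMeasure := by
  rw [← real_inner_self_eq_norm_sq, L2.inner_def]
  simp [pow_two]

lemma integral_abs_le_norm (w : Lp ℝ 2 unitMeasure) : ∫ x, |w x| ∂unitMeasure ≤ ‖w‖ := by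
  have hi : Integrable (fun x => |w x|) unitMeasure :=
    ((Lp.memLp w).integrable (by norm_num)).abs
  have hi2 : Integrable (fun x => w x ^ 2) unitMeasure := (Lp.memLp w).integrable_sq
  set c := ∫ x, |w x| ∂unitMeasure with hc
  have hc0 : 0 ≤ c := integral_nonneg fun x => abs_nonneg _
  -- the variance of `|w|` is nonnegative
  have h1 : 0 ≤ ∫ x, (|w x| - c) ^ 2 ∂unitMeasure := integral_nonneg fun x => sq_nonneg _
  have h2 : ∀ x, (|w x| - c) ^ 2 = w x ^ 2 - 2 * c * |w x| + c ^ 2 := fun x => by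
    rw [sub_sq, sq_abs]
    ring
  simp only [h2] at h1
  have hi3 : Integrable (fun x => 2 * c * |w x|) unitMeasure := hi.const_mul _
  have hi4 : Integrable (fun x => w x ^ 2 - 2 * c * |w x|) unitMeasure := hi2.sub hi3
  rw [integral_add hi4 (integrable_const _), integral_sub hi2 hi3, integral_const_mul, ← hc,
    ← norm_sq_eq_integral] at h1
  simp only [integral_const, probReal_univ, smul_eq_mul, one_mul] at h1
  exact (sq_le_sq₀ hc0 (norm_nonneg w)).1 (by linarith)

namespace IsSolution

variable {σ p₀ : ℝ → ℝ} {T : ℝ} {q : ℝ → ℝ → ℝ}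

lemma mono (hq : IsSolution σ p₀ T q) {T' : ℝ} (hT : T' ≤ T) : IsSolution σ p₀ T' q where
  continuous := by
    obtain ⟨u, hu, huq⟩ := hq.continuous
    exact ⟨u, hu.mono (Icc_subset_Icc le_rfl hT), fun t ht =>
      huq t (Icc_subset_Icc le_rfl hT ht)⟩
  initial := hq.initial
  pos := ae_restrict_of_ae_restrict_of_subset
    (prod_mono le_rfl (Icc_subset_Icc le_rfl hT)) hq.pos
  stress_integrable :=
    ae_restrict_of_ae_restrict_of_subset (Icc_subset_Icc le_rfl hT) hq.stress_integrable
  rhs_integrable := by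
    filter_upwards [hq.rhs_integrable] with x hx τ hτ
    exact (hx τ hτ).mono_set (Ioo_subset_Ioo le_rfl hT)
  equation := by
    filter_upwards [hq.equation] with x hx s hs t ht
    exact hx s (Ioc_subset_Ioc le_rfl hT hs) t (Ioc_subset_Ioc le_rfl hT ht)

/-- For positive times a solution agrees with a flow. The flow is obtained by replacing the indices
in a null set by one good index and by freezing time outside `[τ, T]`; measurability in `x` follows
from the `L²` representatives on a countable dense set of times. -/
lemma exists_flow (hq : IsSolution σ p₀ T q) {τ : ℝ} (hτ : 0 < τ) (hτT : τ < T) :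
    ∃ f S, Flow ((Ioi 0).indicator σ) τ T f S ∧
      ∀ r ∈ Icc τ T, (fun x => f x r) =ᵐ[unitMeasure] fun x => q x r := by
  classical
  obtain ⟨u, -, huq⟩ := hq.continuous
  obtain ⟨D, hDsub, hDc, hDcl⟩ :=
    (TopologicalSpace.IsSeparable.of_separableSpace (Icc τ T)).exists_countable_dense_subset
  have hsub0 : Icc τ T ⊆ Icc 0 T := Icc_subset_Icc hτ.le le_rfl
  have hprodpos : ∀ᵐ z : ℝ × ℝ ∂unitMeasure.prod (volume.restrict (Icc τ T)), 0 < q z.1 z.2 := by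
    have := ae_restrict_of_ae_restrict_of_subset (prod_mono le_rfl hsub0) hq.pos
    rwa [Measure.volume_eq_prod, ← Measure.prod_restrict] at this
  have hpos1 : ∀ᵐ x ∂unitMeasure, ∀ᵐ r ∂volume.restrict (Icc τ T), 0 < q x r :=
    Measure.ae_ae_of_ae_prod hprodpos
  have hpos2 : ∀ᵐ r ∂volume.restrict (Icc τ T), ∀ᵐ x ∂unitMeasure, 0 < q x r :=
    Measure.ae_ae_of_ae_prod (p := fun z : ℝ × ℝ => 0 < q z.2 z.1)
      (Measure.measurePreserving_swap.quasiMeasurePreserving.ae hprodpos)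
  have hD : ∀ᵐ x ∂unitMeasure, ∀ r ∈ D, u r x = q x r :=
    (ae_ball_iff hDc).2 fun r hr => huq r (hsub0 (hDsub hr))
  obtain ⟨G, hG, hGm, hgood⟩ :=
    (hq.rhs_integrable.and (hq.equation.and (hpos1.and hD))).exists_measurable_mem
  obtain ⟨x₀, hx₀⟩ : G.Nonempty := nonempty_of_mem hG
  set π : ℝ → ℝ := fun x => if x ∈ G then x else x₀ with hπ
  have hπm : Measurable π := Measurable.ite hGm measurable_id measurable_const
  have hπG : ∀ x, π x ∈ G := fun x => by
    by_cases hx : x ∈ G <;> simp [hπ, hx, hx₀]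
  set c : ℝ → ℝ := fun r => max τ (min r T) with hc
  have hcI : ∀ r, c r ∈ Icc τ T := fun r =>
    ⟨le_max_left _ _, max_le hτT.le (min_le_right _ _)⟩
  have hcr : ∀ r ∈ Icc τ T, c r = r := fun r hr => by
    simp only [hc, min_eq_left hr.2, max_eq_right hr.1]
  have hcc : Continuous c := by fun_prop
  set S : ℝ → ℝ := fun r => ∫ y, σ (q y r) ∂unitMeasure with hS
  have hqprim : ∀ y ∈ G, IsPrimitiveOn (q y) (fun r => S r - σ (q y r)) τ T := by
    intro y hy
    have h1 := (hgood y hy).1 τ hτ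
    rw [← integrableOn_Icc_iff_integrableOn_Ioo] at h1
    refine ⟨h1.neg.congr (ae_of_all _ fun r => by simp [hS]), fun a ha b hb => ?_⟩
    rw [(hgood y hy).2.1 a ⟨hτ.trans_le ha.1, ha.2⟩ b ⟨hτ.trans_le hb.1, hb.2⟩, sub_eq_add_neg,
      ← intervalIntegral.integral_neg]
    simp [hS]
  have hcont : ∀ x, Continuous fun r => q (π x) (c r) := fun x =>
    (hqprim _ (hπG x)).continuousOn.comp_continuous hcc hcI
  have hposI : ∀ x, ∀ᵐ r ∂volume.restrict (Icc τ T), 0 < q (π x) (c r) := by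
    intro x
    filter_upwards [(hgood _ (hπG x)).2.2.1, ae_restrict_mem measurableSet_Icc] with r hr hrI
    rwa [hcr r hrI]
  have hπae : ∀ᵐ x ∂unitMeasure, π x = x := by
    filter_upwards [hG] with x hx
    simp [hπ, hx]
  refine ⟨fun x r => q (π x) (c r), S, ⟨?_, hcont, hposI, ?_, ?_, ?_⟩, ?_⟩
  · intro r
    obtain ⟨d, hd, hdlim⟩ := mem_closure_iff_seq_limit.1 (hDcl (hcI r))
    refine measurable_of_tendsto_metrizable (f := fun n x => q (π x) (c (d n))) ?_ ?_
    · intro n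
      have : (fun x => q (π x) (c (d n))) = fun x => u (d n) (π x) := by
        ext x
        rw [hcr _ (hDsub (hd n)), (hgood _ (hπG x)).2.2.2 _ (hd n)]
      rw [this]
      exact (Lp.stronglyMeasurable (u (d n))).measurable.comp hπm
    · rw [tendsto_pi_nhds]
      intro x
      have := ((hcont x).tendsto (c r)).comp hdlim
      simpa only [hcr _ (hcI r), Function.comp_def] using this
  · intro x r hr
    have hae : (fun r => q (π x) (c r)) =ᵐ[volume.restrict (Icc τ T)]
        fun r => |q (π x) (c r)| := by
      filter_upwards [hposI x] with r hr
      exact (abs_of_pos hr).symm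
    have := Measure.eqOn_Icc_of_ae_eq volume hτT.ne hae (hcont x).continuousOn
      (hcont x).abs.continuousOn hr
    simp only at this ⊢
    rw [this]
    exact abs_nonneg _
  · intro x
    refine (hqprim _ (hπG x)).congr (fun r hr => by simp only [hcr r hr]) ?_
    filter_upwards [hposI x, ae_restrict_mem measurableSet_Icc] with r hr hrI
    rw [indicator_of_mem (mem_Ioi.2 hr), hcr r hrI]
  · filter_upwards [hpos2, ae_restrict_of_ae_restrict_of_subset hsub0 hq.stress_integrable,
      ae_restrict_mem measurableSet_Icc] with r hr hint hrI
    have hae : (fun x => (Ioi 0).indicator σ (q (π x) (c r))) =ᵐ[unitMeasure]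
        fun x => σ (q x r) := by
      filter_upwards [hr, hπae] with x hx hπx
      rw [hcr r hrI, hπx, indicator_of_mem (mem_Ioi.2 hx)]
    exact ⟨hint.congr hae.symm, (integral_congr_ae hae).symm⟩
  · intro r hr
    filter_upwards [hπae] with x hx
    rw [hcr r hr, hx]

/-- On a time interval on which the mean stays positive, a solution agrees with a bounded flow with
integrable mean stress. -/
lemma exists_bounded_flow (hq : IsSolution σ p₀ T q) (hσ : Admissible σ) {m K : ℝ} (hm : 0 < m)
    (hmean : ∀ r ∈ Icc 0 T, m ≤ ∫ x, q x r ∂unitMeasure ∧ ∫ x, q x r ∂unitMeasure ≤ K)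
    {τ : ℝ} (hτ : 0 < τ) (hτT : τ < T) :
    ∃ f S E, Flow ((Ioi 0).indicator σ) τ T f S ∧ (∀ x, ∀ r ∈ Icc τ T, f x r ≤ E) ∧
      IntegrableOn S (Icc τ T) ∧
      ∀ r ∈ Icc τ T, (fun x => f x r) =ᵐ[unitMeasure] fun x => q x r := by
  have hσ' : Admissible ((Ioi 0).indicator σ) := hσ.congr fun x hx => indicator_of_mem hx σ
  obtain ⟨f, S, hf, hfq⟩ := hq.exists_flow (half_pos hτ) (by linarith : τ / 2 < T)
  have hK : 0 < K := by
    have := hmean 0 ⟨le_rfl, by linarith⟩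
    linarith [this.1, this.2]
  have hsub : Icc (τ / 2) T ⊆ Icc 0 T := Icc_subset_Icc (by linarith) le_rfl
  have hfm : ∀ r ∈ Icc (τ / 2) T,
      ∫ x, f x r ∂unitMeasure = ∫ x, q x r ∂unitMeasure := fun r hr =>
    integral_congr_ae (hfq r hr)
  have hfi : ∀ r ∈ Icc (τ / 2) T, Integrable (fun x => f x r) unitMeasure := by
    intro r hr
    obtain ⟨u, -, huq⟩ := hq.continuous
    exact ((Lp.memLp (u r)).integrable (by norm_num)).congr
      ((huq r (hsub hr)).trans (hfq r hr).symm)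
  obtain ⟨y, hy⟩ := hf.exists_trajectory_le hσ' hK hfi fun r hr => by
    rw [hfm r hr]; exact (hmean r (hsub hr)).2
  obtain ⟨B, hB⟩ := Flow.exists_upper_bound hσ' (2 * K) (τ / 2) (half_pos hτ)
  have hsub' : ∀ r, τ ≤ r → r ≤ T → r ∈ Icc (τ / 2) T := fun r h1 h2 => ⟨by linarith, h2⟩
  have hfE : ∀ x, ∀ r ∈ Icc τ T, f x r ≤ max B 1 := by
    intro x r hr
    refine le_trans (hB (τ / 2) r f S (hf.mono le_rfl hr.2) (by linarith [hr.1]) y ?_ x)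
      (le_max_left _ _)
    exact fun r' hr' => hy r' ⟨hr'.1, hr'.2.trans hr.2⟩
  have hf' := hf.mono (by linarith : τ / 2 ≤ τ) le_rfl
  obtain ⟨w, hw⟩ := hf'.exists_le_trajectory hσ' hm (by positivity) hfE fun r hr => by
    rw [hfm r (hsub' r hr.1 hr.2)]; exact (hmean r (hsub (hsub' r hr.1 hr.2))).1
  exact ⟨f, S, max B 1, hf', hfE, hf'.integrableOn_of_trajectory hσ' (half_pos hm) hw,
    fun r hr => hfq r (hsub' r hr.1 hr.2)⟩

lemma continuousOn_integral (hq : IsSolution σ p₀ T q) :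
    ContinuousOn (fun r => ∫ x, q x r ∂unitMeasure) (Icc 0 T) := by
  obtain ⟨u, hu, huq⟩ := hq.continuous
  have h1 : ContinuousOn (fun r => inner ℝ
      (indicatorConstLp 2 MeasurableSet.univ (measure_ne_top unitMeasure univ) (1 : ℝ)) (u r))
      (Icc 0 T) := continuousOn_const.inner hu
  refine h1.congr fun r hr => ?_
  beta_reduce
  rw [L2.inner_indicatorConstLp_one, setIntegral_univ]
  exact integral_congr_ae (huq r hr).symm

/-- The mean of a solution is conserved. As long as it is positive, the solution agrees for positive
times with a bounded flow, whose mean is constant; hence it can never decrease to half its initial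
value. -/
lemma integral_eq (hq : IsSolution σ p₀ T q) (hσ : Admissible σ) {μ : ℝ} (hμ : 0 < μ)
    (hp₀ : ∫ x, p₀ x ∂unitMeasure = μ) : ∀ t ∈ Icc 0 T, ∫ x, q x t ∂unitMeasure = μ := by
  have hσ' : Admissible ((Ioi 0).indicator σ) := hσ.congr fun x hx => indicator_of_mem hx σ
  have hcont := hq.continuousOn_integral
  have h0 : ∫ x, q x 0 ∂unitMeasure = μ := by rw [integral_congr_ae hq.initial, hp₀]
  obtain ⟨K, hK⟩ := (isCompact_Icc.image_of_continuousOn hcont).bddAbove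
  have claim : ∀ t ∈ Icc 0 T, (∀ r ∈ Icc 0 t, μ / 2 ≤ ∫ x, q x r ∂unitMeasure) →
      ∫ x, q x t ∂unitMeasure = μ := by
    intro t ht hr
    rcases ht.1.eq_or_lt with rfl | ht0
    · exact h0
    have hconst : ∀ τ ∈ Ioo 0 t, ∫ x, q x τ ∂unitMeasure = ∫ x, q x t ∂unitMeasure := by
      intro τ hτ
      obtain ⟨f, S, E, hf, hfE, hS, hfq⟩ := (hq.mono ht.2).exists_bounded_flow hσ
        (half_pos hμ) (fun r hrI => ⟨hr r hrI, hK ⟨r, ⟨hrI.1, hrI.2.trans ht.2⟩, rfl⟩⟩)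
        hτ.1 hτ.2
      rw [← integral_congr_ae (hfq τ ⟨le_rfl, hτ.2.le⟩),
        ← integral_congr_ae (hfq t ⟨hτ.2.le, le_rfl⟩)]
      exact (hf.integral_eq hσ' (measurable_indicator_Ioi hσ) hτ.2.le hfE hS).symm
    have h1 : Tendsto (fun r => ∫ x, q x r ∂unitMeasure) (𝓝[Ioo 0 t] 0) (𝓝 μ) := by
      rw [← h0]
      exact (hcont 0 ⟨le_rfl, ht.1.trans ht.2⟩).mono
        fun r hr => ⟨hr.1.le, hr.2.le.trans ht.2⟩
    have h2 : Tendsto (fun r => ∫ x, q x r ∂unitMeasure) (𝓝[Ioo 0 t] 0)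
        (𝓝 (∫ x, q x t ∂unitMeasure)) := by
      refine tendsto_const_nhds.congr' ?_
      filter_upwards [self_mem_nhdsWithin] with τ hτ using (hconst τ hτ).symm
    have : (𝓝[Ioo 0 t] (0 : ℝ)).NeBot := left_nhdsWithin_Ioo_neBot ht0
    exact tendsto_nhds_unique h2 h1
  set A := Icc 0 T ∩ (fun r => ∫ x, q x r ∂unitMeasure) ⁻¹' Iic (μ / 2) with hA
  rcases A.eq_empty_or_nonempty with hempty | hne
  · intro t ht
    refine claim t ht fun r hr => ?_
    by_contra! hlt
    exact notMem_empty r (hempty ▸ ⟨⟨hr.1, hr.2.trans ht.2⟩, hlt.le⟩)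
  · exfalso
    obtain ⟨t, ⟨htI, htm⟩, hleast⟩ := (isCompact_Icc.of_isClosed_subset
      (hcont.preimage_isClosed_of_isClosed isClosed_Icc isClosed_Iic)
      inter_subset_left).exists_isLeast hne
    have htm' : ∫ x, q x t ∂unitMeasure ≤ μ / 2 := htm
    have hbefore : ∀ r ∈ Icc 0 t, μ / 2 ≤ ∫ x, q x r ∂unitMeasure := by
      intro r hr
      by_contra! hlt
      -- the mean takes the value `μ / 2` before `r`, hence at `r = t`
      obtain ⟨r', hr', heq⟩ := intermediate_value_Icc' hr.1
        (hcont.mono (Icc_subset_Icc le_rfl (hr.2.trans htI.2)))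
        (show μ / 2 ∈ Icc (∫ x, q x r ∂unitMeasure) (∫ x, q x 0 ∂unitMeasure) from
          ⟨hlt.le, by linarith⟩)
      have heq' : ∫ x, q x r' ∂unitMeasure = μ / 2 := heq
      have hr'A : r' ∈ A := ⟨⟨hr'.1, hr'.2.trans (hr.2.trans htI.2)⟩, heq'.le⟩
      have : r' = r := le_antisymm hr'.2 (hr.2.trans (hleast hr'A))
      rw [this] at heq'
      linarith
    have := claim t htI hbefore
    linarith

/-- Solutions with the same initial value agree. -/
lemma unique {p : ℝ → ℝ → ℝ} (hp : IsSolution σ p₀ T p) (hq : IsSolution σ p₀ T q)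
    (hσ : Admissible σ) {μ : ℝ} (hμ : 0 < μ) (hp₀ : ∫ x, p₀ x ∂unitMeasure = μ) :
    ∀ t ∈ Icc 0 T, (fun x => q x t) =ᵐ[unitMeasure] fun x => p x t := by
  have hσ' : Admissible ((Ioi 0).indicator σ) := hσ.congr fun x hx => indicator_of_mem hx σ
  obtain ⟨L, hL, hone⟩ := hσ'.one_sided
  have hpm := hp.integral_eq hσ hμ hp₀
  have hqm := hq.integral_eq hσ hμ hp₀
  obtain ⟨u, hu, hup⟩ := hp.continuous
  obtain ⟨v, hv, hvq⟩ := hq.continuous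
  intro t ht
  rcases ht.1.eq_or_lt with rfl | ht0
  · exact hq.initial.trans hp.initial.symm
  have hstep : ∀ τ ∈ Ioo 0 t, ‖u t - v t‖ ^ 2 ≤ ‖u τ - v τ‖ ^ 2 * Real.exp (2 * L * t) := by
    intro τ hτ
    have hτT : τ < T := hτ.2.trans_le ht.2
    obtain ⟨f, S, E, hf, hfE, hS, hfp⟩ := hp.exists_bounded_flow hσ hμ
      (fun r hr => ⟨(hpm r hr).ge, (hpm r hr).le⟩) hτ.1 hτT
    obtain ⟨g, S', E', hg, hgE, hS', hgq⟩ := hq.exists_bounded_flow hσ hμ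
      (fun r hr => ⟨(hqm r hr).ge, (hqm r hr).le⟩) hτ.1 hτT
    have hsub : Icc τ t ⊆ Icc τ T := Icc_subset_Icc le_rfl ht.2
    have hsub0 : Icc τ T ⊆ Icc 0 T := Icc_subset_Icc hτ.1.le le_rfl
    have hnorm : ∀ r ∈ Icc τ t,
        ‖u r - v r‖ ^ 2 = ∫ x, (f x r - g x r) ^ 2 ∂unitMeasure := by
      intro r hr
      rw [norm_sq_eq_integral]
      apply integral_congr_ae
      filter_upwards [hup r (hsub0 (hsub hr)), hvq r (hsub0 (hsub hr)), hfp r (hsub hr),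
        hgq r (hsub hr), Lp.coeFn_sub (u r) (v r)] with x h1 h2 h3 h4 h5
      rw [h5, Pi.sub_apply, h1, h2, h3, h4]
    have key := (hf.mono le_rfl ht.2).integral_sq_sub_le (hg.mono le_rfl ht.2) hσ'
      (measurable_indicator_Ioi hσ) hτ.2.le hL hone (E := max E E')
      (fun x r hr => (hfE x r (hsub hr)).trans (le_max_left _ _))
      (fun x r hr => (hgE x r (hsub hr)).trans (le_max_right _ _))
      (hS.mono_set hsub) (hS'.mono_set hsub) (fun r hr => by
        rw [integral_congr_ae (hfp r (hsub hr)), integral_congr_ae (hgq r (hsub hr)),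
          hpm r (hsub0 (hsub hr)), hqm r (hsub0 (hsub hr))])
    rw [← hnorm t ⟨hτ.2.le, le_rfl⟩, ← hnorm τ ⟨le_rfl, hτ.2.le⟩] at key
    refine key.trans ?_
    gcongr
    linarith [hτ.1]
  have h00 : ‖u 0 - v 0‖ = 0 := by
    have : u 0 = v 0 := Lp.ext ((hup 0 ⟨le_rfl, ht.1.trans ht.2⟩).trans
      ((hp.initial.trans hq.initial.symm).trans (hvq 0 ⟨le_rfl, ht.1.trans ht.2⟩).symm))
    rw [this, sub_self, norm_zero]
  have hlim : Tendsto (fun τ => ‖u τ - v τ‖ ^ 2 * Real.exp (2 * L * t)) (𝓝[Ioo 0 t] 0)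
      (𝓝 0) := by
    have h1 : Tendsto (fun τ => ‖u τ - v τ‖) (𝓝[Ioo 0 t] 0) (𝓝 ‖u 0 - v 0‖) :=
      ((hu.sub hv).norm 0 ⟨le_rfl, ht.1.trans ht.2⟩).mono
        fun r hr => ⟨hr.1.le, hr.2.le.trans ht.2⟩
    rw [h00] at h1
    simpa using (h1.pow 2).mul_const (Real.exp (2 * L * t))
  have : (𝓝[Ioo 0 t] (0 : ℝ)).NeBot := left_nhdsWithin_Ioo_neBot ht0
  have h1 : ‖u t - v t‖ ^ 2 ≤ 0 := ge_of_tendsto hlim (by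
    filter_upwards [self_mem_nhdsWithin] with τ hτ using hstep τ hτ)
  have h2 : u t - v t = 0 := by
    rw [← norm_eq_zero]
    exact pow_eq_zero_iff two_ne_zero |>.1 (le_antisymm h1 (sq_nonneg _))
  have h3 : u t = v t := sub_eq_zero.1 h2
  exact (hvq t ht).symm.trans (h3 ▸ hup t ht)

end IsSolution

/-! ### Flows with regular initial values -/

/-- A bounded Lipschitz vector field on a Banach space has global integral curves. -/
lemma exists_global_integralCurve {E : Type*} [NormedAddCommGroup E] [NormedSpace ℝ E]
    [CompleteSpace E] {F : E → E} {K C : NNReal} (hK : LipschitzWith K F) (hC : ∀ x, ‖F x‖ ≤ C)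
    (x₀ : E) : ∃ X : ℝ → E, X 0 = x₀ ∧ ∀ t, HasDerivAt X (F (X t)) t := by
  -- as the field is bounded, the Picard-Lindelöf theorem applies on every bounded time interval
  have hloc : ∀ N : ℕ, ∃ X : ℝ → E, X 0 = x₀ ∧ ∀ t ∈ Icc (-(N + 1) : ℝ) (N + 1),
      HasDerivWithinAt X (F (X t)) (Icc (-(N + 1) : ℝ) (N + 1)) t := by
    intro N
    have h0 : (0 : ℝ) ∈ Icc (-(N + 1) : ℝ) (N + 1) := by
      constructor <;> linarith [(Nat.cast_nonneg N : (0 : ℝ) ≤ N)]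
    have hPL : IsPicardLindelof (fun _ => F) (⟨0, h0⟩ : Icc (-(N + 1) : ℝ) (N + 1)) x₀
        (C * (N + 1)) 0 C K :=
      IsPicardLindelof.of_time_independent (fun x _ => hC x) hK.lipschitzOnWith (by simp)
    exact hPL.exists_eq_forall_mem_Icc_hasDerivWithinAt₀
  choose X hX0 hX using hloc
  have hXat : ∀ (N : ℕ) (t : ℝ), t ∈ Ioo (-(N + 1) : ℝ) (N + 1) →
      HasDerivAt (X N) (F (X N t)) t := fun N t ht =>
    (hX N t (Ioo_subset_Icc_self ht)).hasDerivAt (Icc_mem_nhds ht.1 ht.2)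
  have hagree : ∀ N M : ℕ, N ≤ M → EqOn (X N) (X M) (Ioo (-(N + 1) : ℝ) (N + 1)) := by
    intro N M hNM
    have hNM' : (N : ℝ) ≤ M := by exact_mod_cast hNM
    have hN : (0 : ℝ) ≤ N := Nat.cast_nonneg N
    refine ODE_solution_unique_of_mem_Ioo (v := fun _ => F) (s := fun _ => univ) (K := K)
      (t₀ := 0) (fun t _ => hK.lipschitzOnWith) ⟨by linarith, by linarith⟩
      (fun t ht => ⟨hXat N t ht, trivial⟩)
      (fun t ht => ⟨hXat M t ⟨by linarith [ht.1], by linarith [ht.2]⟩, trivial⟩) ?_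
    rw [hX0, hX0]
  refine ⟨fun t => X ⌈|t|⌉₊ t, by simp [hX0], fun t => ?_⟩
  set N := ⌈|t|⌉₊ + 1 with hN
  have hmem : ∀ r : ℝ, r ∈ Ioo (-(⌈|r|⌉₊ + 1) : ℝ) (⌈|r|⌉₊ + 1) := by
    intro r
    have := Nat.le_ceil |r|
    constructor <;> linarith [abs_le.1 this |>.1, abs_le.1 this |>.2]
  have hlt : |t| < (N : ℝ) := by
    rw [hN]
    push_cast
    linarith [Nat.le_ceil |t|]
  have heq : ∀ r, |r| < (N : ℝ) → X ⌈|r|⌉₊ r = X N r := fun r hr =>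
    hagree _ N (Nat.ceil_le.2 hr.le) (hmem r)
  have hev : (fun r => X ⌈|r|⌉₊ r) =ᶠ[𝓝 t] X N := by
    have : ∀ᶠ r in 𝓝 t, |r| < (N : ℝ) := continuous_abs.continuousAt.eventually (gt_mem_nhds hlt)
    filter_upwards [this] with r hr using heq r hr
  have hd := hXat N t (abs_lt.1 (hlt.trans (lt_add_one _)))
  rw [← heq t hlt] at hd
  exact hd.congr_of_eventuallyEq hev

/-- A flow on `[0, ∞)` with values in a compact subset of `(0, ∞)` and with mean `μ`, which
contains a lowest trajectory. -/
structure RegularFlow (σ : ℝ → ℝ) (μ : ℝ) (f : ℝ → ℝ → ℝ) (S : ℝ → ℝ) : Prop where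
  flow : ∀ T, Flow σ 0 T f S
  continuous_stress : Continuous S
  stress_eq : ∀ r, 0 ≤ r →
    Integrable (fun x => σ (f x r)) unitMeasure ∧ S r = ∫ x, σ (f x r) ∂unitMeasure
  bounds : ∃ a b, 0 < a ∧ ∀ x r, 0 ≤ r → a ≤ f x r ∧ f x r ≤ b
  mean : ∀ r, 0 ≤ r → ∫ x, f x r ∂unitMeasure = μ
  lowest : ∃ x₀, ∀ x, f x₀ 0 ≤ f x 0

/-- Existence for initial values in a compact subset of `(0, ∞)`. The trajectories are indexed by
their initial values, so the problem is an ordinary differential equation in `C([a, b])`. After `σ`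
is frozen outside `[a, b]` the vector field is bounded and Lipschitz, and the endpoints, being
record points of `σ`, are barriers. -/
lemma exists_regularFlow {σ : ℝ → ℝ} (hσ : Admissible σ) (hm : Measurable σ) {μ : ℝ} {φ : ℝ → ℝ}
    (hφ : Measurable φ) {a₀ b₀ : ℝ} (ha₀ : 0 < a₀) (hφab : ∀ x, a₀ ≤ φ x ∧ φ x ≤ b₀)
    (hlow : ∃ x₀, ∀ x, φ x₀ ≤ φ x) (hmean : ∫ x, φ x ∂unitMeasure = μ) :
    ∃ f S, RegularFlow σ μ f S ∧ ∀ x, f x 0 = φ x := by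
  obtain ⟨η, hη, hηlow⟩ := hσ.low 0
  set a := min a₀ η with ha
  have ha0 : 0 < a := lt_min ha₀ hη
  obtain ⟨b, hb₀b, hb0, hbhigh⟩ := hσ.high b₀
  have hab : a ≤ b := (min_le_left _ _).trans (((hφab 0).1.trans (hφab 0).2).trans hb₀b)
  have halow : ∀ r, a ≤ r → σ a ≤ σ r := (hηlow a ha0 (min_le_right _ _)).2
  obtain ⟨L, hL⟩ := hσ.lip a b ha0
  set σ' : ℝ → ℝ := fun y => σ (projIcc a b hab y) with hσ'
  have hσ'L : LipschitzWith L σ' := by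
    have := hL.to_restrict.comp (LipschitzWith.projIcc hab)
    rwa [mul_one] at this
  have hσ'eq : ∀ y, a ≤ y → y ≤ b → σ' y = σ y := fun y h1 h2 => by
    simp only [hσ', projIcc_of_mem hab ⟨h1, h2⟩]
  have hσ'ge : ∀ y, σ a ≤ σ' y := fun y => halow _ (projIcc a b hab y).2.1
  have hσ'le : ∀ y, σ' y ≤ σ b := fun y =>
    hbhigh _ (ha0.trans_le (projIcc a b hab y).2.1) (projIcc a b hab y).2.2
  set C : ℝ := max |σ a| |σ b| with hC
  have hσ'C : ∀ y, |σ' y| ≤ C := fun y => abs_le_max_abs_abs (hσ'ge y) (hσ'le y)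
  set ψ : ℝ → Icc a b := fun x =>
    ⟨φ x, (min_le_left _ _).trans (hφab x).1, (hφab x).2.trans hb₀b⟩ with hψ
  have hψm : Measurable ψ := hφ.subtype_mk
  have hXm : ∀ X : C(Icc a b, ℝ), Measurable fun x => σ' (X (ψ x)) := fun X =>
    hσ'L.continuous.measurable.comp (X.continuous.measurable.comp hψm)
  have hXi : ∀ X : C(Icc a b, ℝ), Integrable (fun x => σ' (X (ψ x))) unitMeasure := fun X =>
    Integrable.of_bound (hXm X).aestronglyMeasurable C (ae_of_all _ fun x => hσ'C _)
  set F : C(Icc a b, ℝ) → C(Icc a b, ℝ) := fun X =>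
    ⟨fun k => (∫ x, σ' (X (ψ x)) ∂unitMeasure) - σ' (X k),
      continuous_const.sub (hσ'L.continuous.comp X.continuous)⟩ with hF
  have hFL : LipschitzWith (2 * L) F := by
    refine LipschitzWith.of_dist_le_mul fun X Y => ?_
    rw [ContinuousMap.dist_le (by positivity)]
    intro k
    have h1 : ∀ k, |σ' (X k) - σ' (Y k)| ≤ L * dist X Y := fun k => by
      have := hσ'L.dist_le_mul (X k) (Y k)
      rw [Real.dist_eq] at this
      exact this.trans (mul_le_mul_of_nonneg_left (ContinuousMap.dist_apply_le_dist k) L.2)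
    have h2 : |(∫ x, σ' (X (ψ x)) ∂unitMeasure) - ∫ x, σ' (Y (ψ x)) ∂unitMeasure| ≤
        L * dist X Y := by
      rw [← integral_sub (hXi X) (hXi Y)]
      have := norm_integral_le_of_norm_le_const (μ := unitMeasure)
        (f := fun x => σ' (X (ψ x)) - σ' (Y (ψ x))) (ae_of_all _ fun x => h1 (ψ x))
      simpa using this
    change |((∫ x, σ' (X (ψ x)) ∂unitMeasure) - σ' (X k)) -
      ((∫ x, σ' (Y (ψ x)) ∂unitMeasure) - σ' (Y k))| ≤ _
    have h3 := h1 k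
    push_cast
    rw [abs_le] at h2 h3 ⊢
    constructor <;> linarith [h2.1, h2.2, h3.1, h3.2]
  have hC0 : 0 ≤ C := (abs_nonneg _).trans (le_max_left _ _)
  have hFC : ∀ X, ‖F X‖ ≤ (⟨2 * C, by positivity⟩ : NNReal) := by
    intro X
    rw [ContinuousMap.norm_le _ (by positivity)]
    intro k
    have h2 : |∫ x, σ' (X (ψ x)) ∂unitMeasure| ≤ C := by
      have := norm_integral_le_of_norm_le_const (μ := unitMeasure)
        (f := fun x => σ' (X (ψ x))) (ae_of_all _ fun x => hσ'C (X (ψ x)))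
      simpa using this
    have h3 := hσ'C (X k)
    change |(∫ x, σ' (X (ψ x)) ∂unitMeasure) - σ' (X k)| ≤ 2 * C
    rw [abs_le] at h2 h3 ⊢
    constructor <;> linarith [h2.1, h2.2, h3.1, h3.2]
  obtain ⟨X, hX0, hX⟩ := exists_global_integralCurve hFL hFC
    (⟨fun k => (k : ℝ), continuous_subtype_val⟩ : C(Icc a b, ℝ))
  have hXc : Continuous X := continuous_iff_continuousAt.2 fun t => (hX t).continuousAt
  have hXk : ∀ k, Continuous fun t => X t k := fun k =>
    (continuous_eval_const k).comp hXc
  set S : ℝ → ℝ := fun t => ∫ x, σ' (X t (ψ x)) ∂unitMeasure with hS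
  have hSc : Continuous S := by
    have h1 : Continuous fun t => F (X t) ⟨a, le_rfl, hab⟩ + σ' (X t ⟨a, le_rfl, hab⟩) :=
      ((continuous_eval_const _).comp (hFL.continuous.comp hXc)).add
        (hσ'L.continuous.comp (hXk _))
    refine h1.congr fun t => ?_
    simp [hF, hS]
  have hprim' : ∀ k T, IsPrimitiveOn (fun t => X t k) (fun t => S t - σ' (X t k)) 0 T := by
    intro k T
    refine IsPrimitiveOn.of_hasDerivAt (hSc.sub (hσ'L.continuous.comp (hXk k))) (fun t => ?_) 0 T
    exact ((ContinuousMap.evalCLM ℝ k).hasFDerivAt.comp_hasDerivAt t (hX t))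
  have hSge : ∀ t, σ a ≤ S t := fun t => by
    have := integral_mono (μ := unitMeasure) (integrable_const (σ a)) (hXi (X t))
      fun x => hσ'ge (X t (ψ x))
    simpa using this
  have hSle : ∀ t, S t ≤ σ b := fun t => by
    have := integral_mono (μ := unitMeasure) (hXi (X t)) (integrable_const (σ b))
      fun x => hσ'le (X t (ψ x))
    simpa using this
  have hinv : ∀ k t, 0 ≤ t → a ≤ X t k ∧ X t k ≤ b := by
    intro k t ht
    constructor
    · have := (hprim' k t).neg.le_of_barrier (A := -a) ht (by simp [hX0, k.2.1])
        (ae_of_all _ fun r hr => by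
          have h1 : σ' (X r k) = σ a := by
            simp only [hσ', projIcc_of_le_left hab (show X r k ≤ a by linarith)]
          have := hSge r
          linarith)
      linarith
    · exact (hprim' k t).le_of_barrier (A := b) ht (by simp [hX0, k.2.2])
        (ae_of_all _ fun r hr => by
          have h1 : σ' (X r k) = σ b := by
            simp only [hσ', projIcc_of_right_le hab hr.le]
          have := hSle r
          linarith)
  have hXσ : ∀ k t, 0 ≤ t → σ' (X t k) = σ (X t k) := fun k t ht =>
    hσ'eq _ (hinv k t ht).1 (hinv k t ht).2
  have hstress : ∀ r, 0 ≤ r → Integrable (fun x => σ (X r (ψ x))) unitMeasure ∧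
      S r = ∫ x, σ (X r (ψ x)) ∂unitMeasure := by
    intro r hr
    simp only [hS, ← fun k => hXσ k r hr]
    exact ⟨hXi (X r), trivial⟩
  have hflow : ∀ T, Flow σ 0 T (fun x t => X t (ψ x)) S := fun T =>
    { meas := fun r => (X r).continuous.measurable.comp hψm
      cont := fun x => hXk (ψ x)
      pos := fun x => by
        filter_upwards [ae_restrict_mem measurableSet_Icc] with r hr
        exact ha0.trans_le (hinv _ r hr.1).1
      nonneg := fun x r hr => ha0.le.trans (hinv _ r hr.1).1
      prim := fun x => (hprim' (ψ x) T).congr (fun r _ => rfl) (by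
        filter_upwards [ae_restrict_mem measurableSet_Icc] with r hr
        rw [hXσ _ r hr.1])
      stress := by
        filter_upwards [ae_restrict_mem measurableSet_Icc] with r hr using hstress r hr.1 }
  have hinit : ∀ x, X 0 (ψ x) = φ x := fun x => by rw [hX0]; rfl
  refine ⟨fun x t => X t (ψ x), S, ⟨hflow, hSc, hstress, ⟨a, b, ha0, fun x r hr => hinv _ r hr⟩,
    fun r hr => ?_, ?_⟩, hinit⟩
  · rw [(hflow r).integral_eq hσ hm hr (fun x r' hr' => (hinv _ r' hr'.1).2)
      hSc.integrableOn_Icc]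
    simp only [hinit, hmean]
  · obtain ⟨x₀, hx₀⟩ := hlow
    exact ⟨x₀, fun x => by simpa only [hinit] using hx₀ x⟩

namespace RegularFlow

variable {σ : ℝ → ℝ} {μ : ℝ}

lemma exists_upper_bound (hσ : Admissible σ) (μ : ℝ) {τ : ℝ} (hτ : 0 < τ) :
    ∃ B, ∀ t, τ ≤ t → ∀ f S, RegularFlow σ μ f S → ∀ x, f x t ≤ B := by
  obtain ⟨B, hB⟩ := Flow.exists_upper_bound hσ μ τ hτ
  refine ⟨B, fun t ht f S hf x => ?_⟩
  obtain ⟨x₀, hx₀⟩ := hf.lowest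
  obtain ⟨a, b, -, hab⟩ := hf.bounds
  refine hB 0 t f S (hf.flow t) (by linarith) x₀ (fun r hr => ?_) x
  -- the lowest trajectory lies below the mean
  have h1 : ∀ x, f x₀ r ≤ f x r := fun x => (hf.flow r).le_of_le hσ hr.1 (hx₀ x)
  have h2 := integral_mono (μ := unitMeasure) (integrable_const (f x₀ r))
    ((hf.flow r).integrable_of_le ⟨hr.1, le_rfl⟩ fun x => (hab x r hr.1).2) h1
  rw [hf.mean r hr.1] at h2
  simpa using h2

lemma exists_lower_bound (hσ : Admissible σ) (hμ : 0 < μ) {τ : ℝ} (hτ : 0 < τ) :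
    ∃ B, 0 < B ∧ ∀ t, τ ≤ t → ∀ f S, RegularFlow σ μ f S → ∀ x, B ≤ f x t := by
  obtain ⟨E, hE⟩ := exists_upper_bound hσ μ (half_pos hτ)
  obtain ⟨η, hη, hlow⟩ := Flow.exists_lower_bound hσ hμ (lt_max_of_lt_right one_pos : 0 < max E 1)
  refine ⟨min η (μ / (2 * max E 1) * (τ / 2)), by positivity, fun t ht f S hf x => ?_⟩
  obtain ⟨x₀, hx₀⟩ := hf.lowest
  refine le_trans ?_ (hlow (τ / 2) t f S x₀ ((hf.flow t).mono (by linarith) le_rfl) (by linarith)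
    (fun x => (hf.flow _).le_of_le hσ (by linarith) (hx₀ x))
    (fun x r hr => (hE r hr.1 f S hf x).trans (le_max_left _ _))
    (fun r hr => hf.mean r (by linarith [hr.1])) x)
  gcongr
  linarith

end RegularFlow

/-! ### Approximation of the initial value -/

/-- Nonnegative square-integrable functions with mean `μ` are `L²` limits of functions with the same
mean and with values in compact subsets of `(0, ∞)`: truncate, shrink, and restore the mean by
adding a constant, which is then positive. -/
lemma exists_approx_initial {p₀ : ℝ → ℝ} {μ : ℝ} (hp : MemLp p₀ 2 unitMeasure)
    (h0 : ∀ᵐ x ∂unitMeasure, 0 ≤ p₀ x) (hmean : ∫ x, p₀ x ∂unitMeasure = μ) (hμ : 0 < μ)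
    {ε : ℝ} (hε : 0 < ε) :
    ∃ (φ : ℝ → ℝ) (a₀ b₀ : ℝ), Measurable φ ∧ 0 < a₀ ∧ (∀ x, a₀ ≤ φ x ∧ φ x ≤ b₀) ∧
      (∃ x₀, ∀ x, φ x₀ ≤ φ x) ∧ ∫ x, φ x ∂unitMeasure = μ ∧
      ∫ x, (φ x - p₀ x) ^ 2 ∂unitMeasure < ε := by
  obtain ⟨g, hgm, hg⟩ := hp.1.aemeasurable
  -- a representative that vanishes outside `(0, 1)`, so that its minimum is attained there
  set p : ℝ → ℝ := (Ioo 0 1).indicator fun x => max (g x) 0 with hpdef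
  have hpm : Measurable p := (hgm.max measurable_const).indicator measurableSet_Ioo
  have hp0 : ∀ x, 0 ≤ p x := fun x => indicator_nonneg (fun x _ => le_max_right _ _) x
  have hpae : p =ᵐ[unitMeasure] p₀ := by
    filter_upwards [hg, h0, ae_restrict_mem measurableSet_Ioo] with x h1 h2 h3
    rw [hpdef, indicator_of_mem h3, ← h1, max_eq_left h2]
  have hpL : MemLp p 2 unitMeasure := hp.ae_eq hpae.symm
  have hpi : Integrable p unitMeasure := hpL.integrable (by norm_num)
  have hpmean : ∫ x, p x ∂unitMeasure = μ := by rw [integral_congr_ae hpae, hmean]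
  have hmin0 : ∀ (n : ℕ) x, 0 ≤ min (p x) n := fun n x => le_min (hp0 x) (Nat.cast_nonneg n)
  have hminm : ∀ n : ℕ, Measurable fun x => min (p x) (n : ℝ) := fun n =>
    hpm.min measurable_const
  have hmini : ∀ n : ℕ, Integrable (fun x => min (p x) (n : ℝ)) unitMeasure := fun n =>
    hpi.mono' (hminm n).aestronglyMeasurable (ae_of_all _ fun x => by
      rw [Real.norm_of_nonneg (hmin0 n x)]
      exact min_le_left _ _)
  set l : ℕ → ℝ := fun n => 1 - 1 / ((n : ℝ) + 1) with hl
  have hl1 : ∀ n, l n < 1 := fun n => by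
    have : 0 < 1 / ((n : ℝ) + 1) := Nat.one_div_pos_of_nat
    simp only [hl]
    linarith
  have hl0 : ∀ n, 0 ≤ l n := fun n => by
    have : 1 / ((n : ℝ) + 1) ≤ 1 := by
      rw [div_le_one (by positivity)]
      linarith [(Nat.cast_nonneg n : (0 : ℝ) ≤ n)]
    simp only [hl]
    linarith
  set c : ℕ → ℝ := fun n => μ - l n * ∫ x, min (p x) n ∂unitMeasure with hc
  have hI0 : ∀ n : ℕ, 0 ≤ ∫ x, min (p x) (n : ℝ) ∂unitMeasure := fun n =>
    integral_nonneg (hmin0 n)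
  have hIμ : ∀ n : ℕ, ∫ x, min (p x) (n : ℝ) ∂unitMeasure ≤ μ := fun n => by
    rw [← hpmean]
    exact integral_mono (hmini n) hpi fun x => min_le_left _ _
  have hc0 : ∀ n, 0 < c n := fun n => by
    have := mul_le_mul_of_nonneg_left (hIμ n) (hl0 n)
    have := mul_lt_mul_of_pos_right (hl1 n) hμ
    simp only [hc]
    linarith
  have hcμ : ∀ n, c n ≤ μ := fun n => by
    have := mul_nonneg (hl0 n) (hI0 n)
    simp only [hc]
    linarith
  set φ : ℕ → ℝ → ℝ := fun n x => l n * min (p x) n + c n with hφ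
  have hφlow : ∀ n x, c n ≤ φ n x := fun n x => by
    have := mul_nonneg (hl0 n) (hmin0 n x)
    simp only [hφ]
    linarith
  have hφm : ∀ n, Measurable (φ n) := fun n => ((hminm n).const_mul _).add_const _
  have hllim : Tendsto l atTop (𝓝 1) := by
    simpa [hl] using tendsto_one_div_add_atTop_nhds_zero_nat.const_sub (1 : ℝ)
  have hminlim : ∀ x, Tendsto (fun n : ℕ => min (p x) (n : ℝ)) atTop (𝓝 (p x)) := fun x => by
    refine tendsto_const_nhds.congr' ?_
    filter_upwards [tendsto_natCast_atTop_atTop.eventually_ge_atTop (p x)] with n hn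
    exact (min_eq_left hn).symm
  have hIlim : Tendsto (fun n : ℕ => ∫ x, min (p x) (n : ℝ) ∂unitMeasure) atTop (𝓝 μ) := by
    rw [← hpmean]
    refine tendsto_integral_of_dominated_convergence p
      (fun n => (hminm n).aestronglyMeasurable) hpi (fun n => ae_of_all _ fun x => ?_)
      (ae_of_all _ hminlim)
    rw [Real.norm_of_nonneg (hmin0 n x)]
    exact min_le_left _ _
  have hφlim : ∀ x, Tendsto (fun n => φ n x) atTop (𝓝 (p x)) := fun x => by
    have := (hllim.mul (hminlim x)).add ((hllim.mul hIlim).const_sub μ)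
    simpa using this
  have hlim : Tendsto (fun n => ∫ x, (φ n x - p x) ^ 2 ∂unitMeasure) atTop (𝓝 0) := by
    have hb : Integrable (fun x => (p x + μ) ^ 2) unitMeasure :=
      (hpL.add (memLp_const μ)).integrable_sq
    have := tendsto_integral_of_dominated_convergence (μ := unitMeasure)
      (F := fun n x => (φ n x - p x) ^ 2) (f := fun _ => 0) (fun x => (p x + μ) ^ 2)
      (fun n => (((hφm n).sub hpm).pow_const 2).aestronglyMeasurable) hb
      (fun n => ae_of_all _ fun x => ?_) (ae_of_all _ fun x => ?_)
    · simpa using this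
    · rw [Real.norm_of_nonneg (sq_nonneg _)]
      refine sq_le_sq' ?_ ?_
      · linarith [hφlow n x, hc0 n]
      · have h1 : l n * min (p x) n ≤ 1 * p x :=
          mul_le_mul (hl1 n).le (min_le_left _ _) (hmin0 n x) zero_le_one
        simp only [hφ]
        linarith [hcμ n, hp0 x]
    · simpa using ((hφlim x).sub_const (p x)).pow 2
  obtain ⟨n, hn⟩ := (hlim.eventually (gt_mem_nhds hε)).exists
  refine ⟨φ n, c n, l n * n + c n, hφm n, hc0 n, fun x => ⟨hφlow n x, ?_⟩, ⟨0, fun x => ?_⟩, ?_, ?_⟩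
  · have := mul_le_mul_of_nonneg_left (min_le_right (p x) (n : ℝ)) (hl0 n)
    simp only [hφ]
    linarith
  · have : φ n 0 = c n := by simp [hφ, hpdef]
    rw [this]
    exact hφlow n x
  · simp only [hφ]
    rw [integral_add ((hmini n).const_mul _) (integrable_const _), integral_const_mul]
    simp [hc]
  · refine lt_of_eq_of_lt (integral_congr_ae ?_) hn
    filter_upwards [hpae] with x hx
    rw [hx]

/-! ### Estimates for regular flows -/

namespace RegularFlow

variable {σ : ℝ → ℝ} {μ : ℝ} {f g : ℝ → ℝ → ℝ} {S S' : ℝ → ℝ}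

lemma memLp (hf : RegularFlow σ μ f S) {t : ℝ} (ht : 0 ≤ t) :
    MemLp (fun x => f x t) 2 unitMeasure := by
  obtain ⟨a, b, ha, hab⟩ := hf.bounds
  refine MemLp.of_bound ((hf.flow 0).meas t).aestronglyMeasurable b (ae_of_all _ fun x => ?_)
  rw [Real.norm_of_nonneg (ha.le.trans (hab x t ht).1)]
  exact (hab x t ht).2

/-- A regular flow as a curve in `L²`; negative times are replaced by `0`. -/
noncomputable def toLp (hf : RegularFlow σ μ f S) (t : ℝ) : Lp ℝ 2 unitMeasure :=
  (hf.memLp (le_max_right t 0)).toLp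

lemma coeFn_toLp (hf : RegularFlow σ μ f S) {t : ℝ} (ht : 0 ≤ t) :
    hf.toLp t =ᵐ[unitMeasure] fun x => f x t :=
  (hf.memLp (le_max_right t 0)).coeFn_toLp.trans (by rw [max_eq_left ht])

lemma norm_sub_sq (hf : RegularFlow σ μ f S) (hg : RegularFlow σ μ g S') {t s : ℝ} (ht : 0 ≤ t)
    (hs : 0 ≤ s) :
    ‖hf.toLp t - hg.toLp s‖ ^ 2 = ∫ x, (f x t - g x s) ^ 2 ∂unitMeasure := by
  rw [norm_sq_eq_integral]
  apply integral_congr_ae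
  filter_upwards [hf.coeFn_toLp ht, hg.coeFn_toLp hs, Lp.coeFn_sub (hf.toLp t) (hg.toLp s)]
    with x h1 h2 h3
  rw [h3, Pi.sub_apply, h1, h2]

lemma continuousOn_toLp (hf : RegularFlow σ μ f S) : ContinuousOn hf.toLp (Ici 0) := by
  obtain ⟨a, b, ha, hab⟩ := hf.bounds
  intro t ht
  have h1 : Tendsto (fun s => ∫ x, (f x s - f x t) ^ 2 ∂unitMeasure) (𝓝[Ici 0] t)
      (𝓝 (∫ _, (0 : ℝ) ∂unitMeasure)) := by
    refine tendsto_integral_filter_of_dominated_convergence (fun _ => b ^ 2)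
      (Eventually.of_forall fun s =>
        ((((hf.flow 0).meas s).sub ((hf.flow 0).meas t)).pow_const 2).aestronglyMeasurable)
      ?_ (integrable_const _) (ae_of_all _ fun x => ?_)
    · filter_upwards [self_mem_nhdsWithin] with s hs
      refine ae_of_all _ fun x => ?_
      rw [Real.norm_of_nonneg (sq_nonneg _)]
      refine sq_le_sq' ?_ ?_ <;> linarith [hab x s hs, hab x t ht]
    · have := (((hf.flow 0).cont x).tendsto t).mono_left (nhdsWithin_le_nhds (s := Ici 0))
      simpa using (this.sub_const (f x t)).pow 2
  rw [ContinuousWithinAt, tendsto_iff_norm_sub_tendsto_zero]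
  have h2 : Tendsto (fun s => ‖hf.toLp s - hf.toLp t‖ ^ 2) (𝓝[Ici 0] t) (𝓝 0) := by
    rw [integral_zero] at h1
    refine h1.congr' ?_
    filter_upwards [self_mem_nhdsWithin] with s hs
    exact (hf.norm_sub_sq hf hs ht).symm
  have h3 := h2.sqrt
  simpa using h3

lemma norm_sub_le (hf : RegularFlow σ μ f S) (hg : RegularFlow σ μ g S') (hσ : Admissible σ)
    (hm : Measurable σ) {L : ℝ} (hL : 0 ≤ L)
    (hone : ∀ a b, 0 < a → a ≤ b → σ a - σ b ≤ L * (b - a)) {t : ℝ} (ht : 0 ≤ t) :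
    ‖hf.toLp t - hg.toLp t‖ ≤ ‖hf.toLp 0 - hg.toLp 0‖ * Real.exp (L * t) := by
  obtain ⟨a, b, -, hab⟩ := hf.bounds
  obtain ⟨a', b', -, hab'⟩ := hg.bounds
  have key := (hf.flow t).integral_sq_sub_le (hg.flow t) hσ hm ht hL hone (E := max b b')
    (fun x r hr => (hab x r hr.1).2.trans (le_max_left _ _))
    (fun x r hr => (hab' x r hr.1).2.trans (le_max_right _ _))
    hf.continuous_stress.integrableOn_Icc hg.continuous_stress.integrableOn_Icc
    (fun r hr => by rw [hf.mean r hr.1, hg.mean r hr.1])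
  rw [← hf.norm_sub_sq hg ht ht, ← hf.norm_sub_sq hg le_rfl le_rfl, sub_zero] at key
  refine (sq_le_sq₀ (norm_nonneg _) (by positivity)).1 (key.trans_eq ?_)
  rw [mul_pow, ← Real.exp_nat_mul]
  push_cast
  rw [mul_assoc]

lemma abs_stress_sub_le (hf : RegularFlow σ μ f S) (hg : RegularFlow σ μ g S') {a b r : ℝ}
    (hr : 0 ≤ r) {l : NNReal} (hl : LipschitzOnWith l σ (Icc a b))
    (hfab : ∀ x, f x r ∈ Icc a b) (hgab : ∀ x, g x r ∈ Icc a b) :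
    |S r - S' r| ≤ l * ‖hf.toLp r - hg.toLp r‖ := by
  have hfS := hf.stress_eq r hr
  have hgS := hg.stress_eq r hr
  rw [hfS.2, hgS.2, ← integral_sub hfS.1 hgS.1]
  have hw := ((Lp.memLp (hf.toLp r - hg.toLp r)).integrable (by norm_num)).abs
  calc |∫ x, (σ (f x r) - σ (g x r)) ∂unitMeasure|
      ≤ ∫ x, |σ (f x r) - σ (g x r)| ∂unitMeasure := abs_integral_le_integral_abs
    _ ≤ ∫ x, l * |(hf.toLp r - hg.toLp r) x| ∂unitMeasure := by
        refine integral_mono_ae (hfS.1.sub hgS.1).abs (hw.const_mul _) ?_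
        filter_upwards [hf.coeFn_toLp hr, hg.coeFn_toLp hr,
          Lp.coeFn_sub (hf.toLp r) (hg.toLp r)] with x h1 h2 h3
        rw [h3, Pi.sub_apply, h1, h2]
        exact hl.dist_le_mul _ (hfab x) _ (hgab x)
    _ = l * ∫ x, |(hf.toLp r - hg.toLp r) x| ∂unitMeasure := integral_const_mul _ _
    _ ≤ l * ‖hf.toLp r - hg.toLp r‖ := by
        gcongr
        exact integral_abs_le_norm _

/-- Trajectories depend continuously on their value at one time and on the mean stress. -/
lemma sub_le_gronwall (hf : RegularFlow σ μ f S) (hg : RegularFlow σ μ g S') {L : ℝ} (hL : 0 ≤ L)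
    (hone : ∀ a b, 0 < a → a ≤ b → σ a - σ b ≤ L * (b - a)) {s t η : ℝ} (hs : 0 ≤ s) (hst : s ≤ t)
    (hη : 0 ≤ η) (hS : ∀ r ∈ Icc s t, |S r - S' r| ≤ η) (x : ℝ) :
    f x t - g x t ≤ (|f x s - g x s| + η * (t - s)) * Real.exp (L * (t - s)) := by
  have hf' := (hf.flow t).mono hs le_rfl
  have hg' := (hg.flow t).mono hs le_rfl
  refine ((hf'.prim x).sub (hg'.prim x)).le_gronwall hst hL (abs_nonneg _) hη (le_abs_self _) ?_
  filter_upwards [hg'.pos x, ae_restrict_mem measurableSet_Icc] with r hpos hr hlt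
  have h1 := hone _ _ hpos (show g x r ≤ f x r by linarith)
  have h2 := (abs_le.1 (hS r hr)).2
  linarith

lemma abs_sub_le_gronwall (hf : RegularFlow σ μ f S) (hg : RegularFlow σ μ g S') {L : ℝ}
    (hL : 0 ≤ L) (hone : ∀ a b, 0 < a → a ≤ b → σ a - σ b ≤ L * (b - a)) {s t η : ℝ} (hs : 0 ≤ s)
    (hst : s ≤ t) (hη : 0 ≤ η) (hS : ∀ r ∈ Icc s t, |S r - S' r| ≤ η) (x : ℝ) :
    |f x t - g x t| ≤ (|f x s - g x s| + η * (t - s)) * Real.exp (L * (t - s)) := by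
  have h1 := hf.sub_le_gronwall hg hL hone hs hst hη hS x
  have h2 := hg.sub_le_gronwall hf hL hone hs hst hη
    (fun r hr => by rw [abs_sub_comm]; exact hS r hr) x
  rw [abs_sub_comm (g x s)] at h2
  exact abs_le.2 ⟨by linarith, h1⟩

end RegularFlow

/-! ### Passage to the limit -/

/-- Regular flows whose initial values converge in `L²` and that obey common bounds at positive times
converge to a solution. The `L²` stability gives convergence in `L²`, hence of the mean stresses,
uniformly on compact time intervals in `(0, ∞)`, and almost everywhere convergence at each fixed
time; the trajectories of almost every `x` then converge because each of them solves a scalar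
equation with converging forcing. -/
theorem exists_solution_of_approx {σ : ℝ → ℝ} {μ : ℝ} (hσ : Admissible σ) (hm : Measurable σ)
    {p₀ : ℝ → ℝ} (hp : MemLp p₀ 2 unitMeasure) {f : ℕ → ℝ → ℝ → ℝ} {S : ℕ → ℝ → ℝ}
    (hf : ∀ n, RegularFlow σ μ (f n) (S n))
    (hinit : ∀ n, ‖(hf n).toLp 0 - hp.toLp‖ ≤ (1 / 2) ^ n)
    {a b : ℝ → ℝ} (ha : ∀ t, 0 < t → 0 < a t) (hamono : MonotoneOn a (Ioi 0))
    (hbanti : AntitoneOn b (Ioi 0)) (hab : ∀ n x t, 0 < t → a t ≤ f n x t ∧ f n x t ≤ b t) :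
    ∃ p : ℝ → ℝ → ℝ, (∀ T, IsSolution σ p₀ T p) ∧
      ∀ t, 0 < t → ∀ᵐ x ∂unitMeasure, a t ≤ p x t ∧ p x t ≤ b t := by
  obtain ⟨L, hL, hone⟩ := hσ.one_sided
  have hhalf : Tendsto (fun n : ℕ => (1 / 2 : ℝ) ^ n) atTop (𝓝 0) :=
    tendsto_pow_atTop_nhds_zero_of_lt_one (by norm_num) (by norm_num)
  have hcauchy : ∀ N n m : ℕ, N ≤ n → N ≤ m → ∀ t, 0 ≤ t →
      ‖(hf n).toLp t - (hf m).toLp t‖ ≤ 2 * (1 / 2) ^ N * Real.exp (L * t) := by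
    intro N n m hn hm' t ht
    refine ((hf n).norm_sub_le (hf m) hσ hm hL hone ht).trans ?_
    gcongr
    have h1 : ∀ k, N ≤ k → (1 / 2 : ℝ) ^ k ≤ (1 / 2) ^ N := fun k hk =>
      pow_le_pow_of_le_one (by norm_num) (by norm_num) hk
    have h2 := norm_sub_le_norm_sub_add_norm_sub ((hf n).toLp 0) hp.toLp ((hf m).toLp 0)
    rw [norm_sub_rev hp.toLp] at h2
    linarith [hinit n, hinit m, h1 n hn, h1 m hm']
  set p : ℝ → ℝ → ℝ := fun x t => limUnder atTop fun n => f n x t with hpdef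
  have hlimp : ∀ x t, (∃ y, Tendsto (fun n => f n x t) atTop (𝓝 y)) →
      Tendsto (fun n => f n x t) atTop (𝓝 (p x t)) := fun x t h => tendsto_nhds_limUnder h
  -- convergence almost everywhere at a fixed time
  have hae : ∀ t, 0 ≤ t → ∀ᵐ x ∂unitMeasure, Tendsto (fun n => f n x t) atTop (𝓝 (p x t)) := by
    intro t ht
    have hB : Summable fun N : ℕ => 3 * (1 / 2 : ℝ) ^ N * Real.exp (L * t) :=
      ((summable_geometric_of_lt_one (by norm_num) (by norm_num)).mul_left 3).mul_right _
    have := Lp.ae_tendsto_of_cauchy_eLpNorm (μ := unitMeasure) (f := fun n x => f n x t) (p := 2)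
      (fun n => (((hf n).flow 0).meas t).aestronglyMeasurable) (by norm_num)
      hB.tsum_ofReal_ne_top (fun N n m hn hm' => by
        have h1 : eLpNorm ((fun x => f n x t) - fun x => f m x t) 2 unitMeasure =
            ENNReal.ofReal ‖(hf n).toLp t - (hf m).toLp t‖ := by
          rw [ofReal_norm, Lp.enorm_def]
          apply eLpNorm_congr_ae
          filter_upwards [(hf n).coeFn_toLp ht, (hf m).coeFn_toLp ht,
            Lp.coeFn_sub ((hf n).toLp t) ((hf m).toLp t)] with x h1 h2 h3
          rw [h3, Pi.sub_apply, Pi.sub_apply, h1, h2]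
        rw [h1]
        refine (ENNReal.ofReal_lt_ofReal_iff (by positivity)).2
          ((hcauchy N n m hn hm' t ht).trans_lt ?_)
        gcongr
        norm_num)
    filter_upwards [this] with x hx using hlimp x t hx
  -- convergence in `L²`
  have hL2 : ∀ t, ∃ u : Lp ℝ 2 unitMeasure, 0 ≤ t →
      Tendsto (fun n => (hf n).toLp t) atTop (𝓝 u) := by
    intro t
    by_cases ht : 0 ≤ t
    · have : CauchySeq fun n => (hf n).toLp t := by
        refine cauchySeq_of_le_tendsto_0' (fun N : ℕ => 2 * (1 / 2 : ℝ) ^ N * Real.exp (L * t))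
          (fun n m hnm => ?_) ?_
        · rw [dist_eq_norm]
          exact hcauchy n n m le_rfl hnm t ht
        · simpa using (hhalf.const_mul 2).mul_const (Real.exp (L * t))
      obtain ⟨u, hu⟩ := cauchySeq_tendsto_of_complete this
      exact ⟨u, fun _ => hu⟩
    · exact ⟨0, fun h => absurd h ht⟩
  choose u hu using hL2
  have hup : ∀ t, 0 ≤ t → u t =ᵐ[unitMeasure] fun x => p x t := by
    intro t ht
    obtain ⟨ns, hns, hlim⟩ := (tendstoInMeasure_of_tendsto_Lp (hu t ht)).exists_seq_tendsto_ae
    have hall : ∀ᵐ x ∂unitMeasure, ∀ n, (hf n).toLp t x = f n x t :=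
      ae_all_iff.2 fun n => (hf n).coeFn_toLp ht
    filter_upwards [hlim, hall, hae t ht] with x h1 h2 h3
    simp only [h2] at h1
    exact tendsto_nhds_unique h1 (h3.comp hns.tendsto_atTop)
  have hucont : ∀ T, ContinuousOn u (Icc 0 T) := by
    intro T
    have hunif : TendstoUniformlyOn (fun n t => (hf n).toLp t) u atTop (Icc 0 T) := by
      rw [Metric.tendstoUniformlyOn_iff]
      intro ε hε
      have h1 : Tendsto (fun N : ℕ => 2 * (1 / 2 : ℝ) ^ N * Real.exp (L * T)) atTop (𝓝 0) := by
        simpa using (hhalf.const_mul 2).mul_const (Real.exp (L * T))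
      filter_upwards [h1.eventually (gt_mem_nhds hε)] with n hn t ht
      have h2 : ‖(hf n).toLp t - u t‖ ≤ 2 * (1 / 2) ^ n * Real.exp (L * t) := by
        refine le_of_tendsto ((hu t ht.1).const_sub _).norm ?_
        filter_upwards [eventually_ge_atTop n] with m hnm using hcauchy n n m le_rfl hnm t ht.1
      rw [dist_eq_norm, norm_sub_rev]
      refine (h2.trans ?_).trans_lt hn
      gcongr
      exact ht.2
    exact hunif.continuousOn (Eventually.of_forall fun n =>
      (hf n).continuousOn_toLp.mono Icc_subset_Ici_self).frequently
  -- convergence of the trajectories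
  set Good : ℝ → Prop := fun x => ∀ t, 0 < t → Tendsto (fun n => f n x t) atTop (𝓝 (p x t))
  have hgood : ∀ᵐ x ∂unitMeasure, Good x := by
    have hall : ∀ᵐ x ∂unitMeasure, ∀ k : ℕ,
        Tendsto (fun n => f n x (1 / ((k : ℝ) + 1))) atTop (𝓝 (p x (1 / ((k : ℝ) + 1)))) :=
      ae_all_iff.2 fun k => hae _ (by positivity)
    filter_upwards [hall] with x hx t ht
    apply hlimp
    obtain ⟨k, hk⟩ := exists_nat_one_div_lt ht
    set s : ℝ := 1 / ((k : ℝ) + 1) with hs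
    have hs0 : 0 < s := Nat.one_div_pos_of_nat
    obtain ⟨l, hl⟩ := hσ.lip (a s) (b s) (ha s hs0)
    have hmem : ∀ n y r, s ≤ r → f n y r ∈ Icc (a s) (b s) := fun n y r hr =>
      ⟨(hamono hs0 (hs0.trans_le hr) hr).trans (hab n y r (hs0.trans_le hr)).1,
        (hab n y r (hs0.trans_le hr)).2.trans (hbanti hs0 (hs0.trans_le hr) hr)⟩
    have hcs : CauchySeq fun n => f n x s := (hx k).cauchySeq
    set e : ℕ → ℝ := fun N => l * (2 * (1 / 2) ^ N * Real.exp (L * t)) with he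
    have he0 : ∀ N, 0 ≤ e N := fun N => by positivity
    have helim : Tendsto e atTop (𝓝 0) := by
      simpa [he] using ((hhalf.const_mul 2).mul_const (Real.exp (L * t))).const_mul (l : ℝ)
    have hbound : ∀ N n m, N ≤ n → N ≤ m → |f n x t - f m x t| ≤
        (|f n x s - f m x s| + e N * (t - s)) * Real.exp (L * (t - s)) := by
      intro N n m hn hm'
      refine (hf n).abs_sub_le_gronwall (hf m) hL hone hs0.le hk.le (he0 N) (fun r hr => ?_) x
      have hr0 : 0 ≤ r := hs0.le.trans hr.1
      refine ((hf n).abs_stress_sub_le (hf m) hr0 hl (fun y => hmem n y r hr.1)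
        (fun y => hmem m y r hr.1)).trans ?_
      simp only [he]
      refine mul_le_mul_of_nonneg_left ((hcauchy N n m hn hm' r hr0).trans ?_) l.2
      gcongr
      exact hr.2
    apply cauchySeq_tendsto_of_complete
    rw [Metric.cauchySeq_iff] at hcs ⊢
    intro ε hε
    set X := Real.exp (L * (t - s)) with hX
    have hX0 : 0 < X := Real.exp_pos _
    have hts : 0 ≤ t - s := by linarith
    obtain ⟨N₁, hN₁⟩ := hcs (ε / (2 * X)) (by positivity)
    have h1 : Tendsto (fun N => e N * (t - s) * X) atTop (𝓝 0) := by
      simpa using (helim.mul_const (t - s)).mul_const X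
    obtain ⟨N₂, hN₂⟩ := (h1.eventually (gt_mem_nhds (half_pos hε))).exists_forall_of_atTop
    refine ⟨max N₁ N₂, fun n hn m hm' => ?_⟩
    rw [Real.dist_eq]
    refine (hbound (max N₁ N₂) n m hn hm').trans_lt ?_
    have h2 := hN₁ n ((le_max_left _ _).trans hn) m ((le_max_left _ _).trans hm')
    rw [Real.dist_eq] at h2
    have h3 := hN₂ (max N₁ N₂) (le_max_right _ _)
    have h4 : |f n x s - f m x s| * X < ε / (2 * X) * X := by gcongr
    have h5 : ε / (2 * X) * X = ε / 2 := by field_simp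
    rw [add_mul]
    linarith
  have hpab : ∀ x, Good x → ∀ t, 0 < t → a t ≤ p x t ∧ p x t ≤ b t := fun x hx t ht =>
    ⟨ge_of_tendsto (hx t ht) (Eventually.of_forall fun n => (hab n x t ht).1),
      le_of_tendsto (hx t ht) (Eventually.of_forall fun n => (hab n x t ht).2)⟩
  have hσlim : ∀ x, Good x → ∀ t, 0 < t →
      Tendsto (fun n => σ (f n x t)) atTop (𝓝 (σ (p x t))) := fun x hx t ht =>
    ((hσ.continuousOn.continuousAt (Ioi_mem_nhds ((ha t ht).trans_le (hpab x hx t ht).1))).tendsto).comp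
      (hx t ht)
  -- bounds for the stress
  have hσC : ∀ τ, 0 < τ → ∃ C, ∀ y, a τ ≤ y → y ≤ b τ → |σ y| ≤ C := by
    intro τ hτ
    obtain ⟨C, hC⟩ := isCompact_Icc.exists_bound_of_continuousOn
      (hσ.continuousOn.mono fun y (hy : y ∈ Icc (a τ) (b τ)) => (ha τ hτ).trans_le hy.1)
    exact ⟨C, fun y h1 h2 => hC y ⟨h1, h2⟩⟩
  have hfab : ∀ τ, 0 < τ → ∀ n x t, τ ≤ t → a τ ≤ f n x t ∧ f n x t ≤ b τ := fun τ hτ n x t ht =>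
    ⟨(hamono hτ (hτ.trans_le ht) ht).trans (hab n x t (hτ.trans_le ht)).1,
      (hab n x t (hτ.trans_le ht)).2.trans (hbanti hτ (hτ.trans_le ht) ht)⟩
  set S' : ℝ → ℝ := fun t => ∫ x, σ (p x t) ∂unitMeasure with hS'
  have hSlim : ∀ t, 0 < t → Integrable (fun x => σ (p x t)) unitMeasure ∧
      Tendsto (fun n => S n t) atTop (𝓝 (S' t)) := by
    intro t ht
    obtain ⟨C, hC⟩ := hσC t ht
    have hlim : ∀ᵐ x ∂unitMeasure, Tendsto (fun n => σ (f n x t)) atTop (𝓝 (σ (p x t))) := by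
      filter_upwards [hgood] with x hx using hσlim x hx t ht
    have hmeas : ∀ n, AEStronglyMeasurable (fun x => σ (f n x t)) unitMeasure := fun n =>
      ((hf n).stress_eq t ht.le).1.aestronglyMeasurable
    constructor
    · refine Integrable.of_bound (aestronglyMeasurable_of_tendsto_ae atTop hmeas hlim) C ?_
      filter_upwards [hgood] with x hx
      exact hC _ (hpab x hx t ht).1 (hpab x hx t ht).2
    · refine (tendsto_integral_of_dominated_convergence (fun _ => C) hmeas (integrable_const C)
        (fun n => ae_of_all _ fun x => hC _ (hab n x t ht).1 (hab n x t ht).2) hlim).congr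
        fun n => ((hf n).stress_eq t ht.le).2.symm
  have hprim : ∀ x, Good x → ∀ τ T, 0 < τ →
      IsPrimitiveOn (p x) (fun r => S' r - σ (p x r)) τ T := by
    intro x hx τ T hτ
    obtain ⟨C, hC⟩ := hσC τ hτ
    refine IsPrimitiveOn.of_tendsto (C := 2 * C)
      (fun n => (((hf n).flow T).mono hτ.le le_rfl).prim x)
      (fun r hr => hx r (hτ.trans_le hr.1))
      (fun r hr => (hSlim r (hτ.trans_le hr.1)).2.sub (hσlim x hx r (hτ.trans_le hr.1)))
      (fun n r hr => ?_)
    have h1 : ∀ y, |σ (f n y r)| ≤ C := fun y =>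
      hC _ (hfab τ hτ n y r hr.1).1 (hfab τ hτ n y r hr.1).2
    have h2 : |S n r| ≤ C := by
      rw [((hf n).stress_eq r (hτ.le.trans hr.1)).2]
      have := norm_integral_le_of_norm_le_const (μ := unitMeasure)
        (f := fun y => σ (f n y r)) (ae_of_all _ fun y => h1 y)
      simpa using this
    have h3 := h1 x
    rw [abs_le] at h2 h3 ⊢
    constructor <;> linarith [h2.1, h2.2, h3.1, h3.2]
  refine ⟨p, fun T => ⟨⟨u, hucont T, fun t ht => hup t ht.1⟩, ?_, ?_, ?_, ?_, ?_⟩, fun t ht => ?_⟩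
  · have h1 : Tendsto (fun n => (hf n).toLp 0) atTop (𝓝 hp.toLp) := by
      rw [tendsto_iff_norm_sub_tendsto_zero]
      exact squeeze_zero (fun n => norm_nonneg _) hinit hhalf
    have h2 : u 0 = hp.toLp := tendsto_nhds_unique (hu 0 le_rfl) h1
    exact (hup 0 le_rfl).symm.trans (h2 ▸ hp.coeFn_toLp)
  · rw [Measure.volume_eq_prod, ← Measure.prod_restrict]
    have h1 : ∀ᵐ z : ℝ × ℝ ∂unitMeasure.prod (volume.restrict (Icc 0 T)), Good z.1 :=
      Measure.quasiMeasurePreserving_fst.ae hgood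
    have h2 : ∀ᵐ z : ℝ × ℝ ∂unitMeasure.prod (volume.restrict (Icc 0 T)), 0 < z.2 := by
      refine Measure.quasiMeasurePreserving_snd.ae (p := fun r => 0 < r) ?_
      rw [← restrict_Ioc_eq_restrict_Icc]
      filter_upwards [ae_restrict_mem measurableSet_Ioc] with r hr using hr.1
    filter_upwards [h1, h2] with z hz1 hz2
    exact (ha _ hz2).trans_le (hpab _ hz1 _ hz2).1
  · rw [← restrict_Ioc_eq_restrict_Icc]
    filter_upwards [ae_restrict_mem measurableSet_Ioc] with t ht using (hSlim t ht.1).1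
  · filter_upwards [hgood] with x hx τ hτ
    refine ((hprim x hx τ T hτ).1.neg.mono_set Ioo_subset_Icc_self).congr
      (ae_of_all _ fun r => ?_)
    simp [hS']
  · filter_upwards [hgood] with x hx s hs t ht
    have hst := (hprim x hx (min s t) T (lt_min hs.1 ht.1)).2 s ⟨min_le_left _ _, hs.2⟩ t
      ⟨min_le_right _ _, ht.2⟩
    rw [hst, sub_eq_add_neg, ← intervalIntegral.integral_neg]
    simp [hS']
  · filter_upwards [hgood] with x hx using hpab x hx t ht

/-! ### Well-posedness and uniform bounds -/

/-- Only the values of the stress on `(0, ∞)` matter. -/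
lemma IsSolution.congr_stress {σ σ' p₀ : ℝ → ℝ} {T : ℝ} {p : ℝ → ℝ → ℝ}
    (hp : IsSolution σ p₀ T p) (h : EqOn σ' σ (Ioi 0)) : IsSolution σ' p₀ T p := by
  have hprod : ∀ᵐ z : ℝ × ℝ ∂unitMeasure.prod (volume.restrict (Icc 0 T)), 0 < p z.1 z.2 := by
    have := hp.pos
    rwa [Measure.volume_eq_prod, ← Measure.prod_restrict] at this
  have h1 : ∀ᵐ x ∂unitMeasure, ∀ᵐ r ∂volume.restrict (Icc 0 T), 0 < p x r :=
    Measure.ae_ae_of_ae_prod hprod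
  have h2 : ∀ᵐ r ∂volume.restrict (Icc 0 T),
      (fun x => σ (p x r)) =ᵐ[unitMeasure] fun x => σ' (p x r) := by
    have : ∀ᵐ r ∂volume.restrict (Icc 0 T), ∀ᵐ x ∂unitMeasure, 0 < p x r :=
      Measure.ae_ae_of_ae_prod (p := fun z : ℝ × ℝ => 0 < p z.2 z.1)
        (Measure.measurePreserving_swap.quasiMeasurePreserving.ae hprod)
    filter_upwards [this] with r hr
    filter_upwards [hr] with x hx using (h hx).symm
  have h3 : ∀ᵐ x ∂unitMeasure, (fun r => σ (p x r) - ∫ y, σ (p y r) ∂unitMeasure)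
      =ᵐ[volume.restrict (Icc 0 T)] fun r => σ' (p x r) - ∫ y, σ' (p y r) ∂unitMeasure := by
    filter_upwards [h1] with x hx
    filter_upwards [hx, h2] with r hr hr2
    rw [integral_congr_ae hr2, h hr]
  refine ⟨hp.continuous, hp.initial, hp.pos, ?_, ?_, ?_⟩
  · filter_upwards [hp.stress_integrable, h2] with r hr hr2 using hr.congr hr2
  · filter_upwards [hp.rhs_integrable, h3] with x hx hx3 τ hτ
    have hsub : Ioo τ T ⊆ Icc 0 T := fun r hr => ⟨hτ.le.trans hr.1.le, hr.2.le⟩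
    exact (hx τ hτ).congr (ae_restrict_of_ae_restrict_of_subset hsub hx3)
  · filter_upwards [hp.equation, h3] with x hx hx3 s hs t ht
    have hsub : uIoc s t ⊆ Icc 0 T := uIoc_subset_uIcc.trans
      (ordConnected_Icc.uIcc_subset ⟨hs.1.le, hs.2⟩ ⟨ht.1.le, ht.2⟩)
    rw [hx s hs t ht, intervalIntegral.integral_congr_ae_restrict
      (ae_restrict_of_ae_restrict_of_subset hsub hx3)]

/-- Monotone bounds for all regular flows with mean `μ`. -/
lemma exists_bounds {σ : ℝ → ℝ} {μ : ℝ} (hσ : Admissible σ) (hμ : 0 < μ) :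
    ∃ ε E : ℝ → ℝ,
      (ContinuousOn ε (Ici 0) ∧ MonotoneOn ε (Ici 0) ∧ ε 0 = 0 ∧
        ∀ t : ℝ, 0 < t → 0 < ε t ∧ ε t < μ) ∧
      (ContinuousOn E (Ioi 0) ∧ AntitoneOn E (Ioi 0) ∧ Tendsto E (𝓝[>] 0) atTop ∧
        ∀ t : ℝ, 0 < t → μ < E t) ∧
      ∀ f S, RegularFlow σ μ f S → ∀ x t, 0 < t → ε t ≤ f x t ∧ f x t ≤ E t := by
  obtain ⟨E, hEc, hEa, hElim, hE⟩ := exists_continuous_antitone_bound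
    (fun t B => ∀ f S, RegularFlow σ μ f S → ∀ x, f x t ≤ B)
    (fun t B B' hBB' h f S hf x => (h f S hf x).trans hBB')
    (fun τ hτ => RegularFlow.exists_upper_bound hσ μ hτ) μ
  -- the reciprocal of the lower bound
  obtain ⟨D, hDc, hDa, hDlim, hD⟩ := exists_continuous_antitone_bound
    (fun t B => 0 < B ∧ ∀ f S, RegularFlow σ μ f S → ∀ x, B⁻¹ ≤ f x t)
    (fun t B B' hBB' h => ⟨h.1.trans_le hBB', fun f S hf x =>
      (inv_anti₀ h.1 hBB').trans (h.2 f S hf x)⟩)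
    (fun τ hτ => by
      obtain ⟨B, hB, h⟩ := RegularFlow.exists_lower_bound hσ hμ hτ
      exact ⟨B⁻¹, fun t ht => ⟨inv_pos.2 hB, fun f S hf x => by
        rw [inv_inv]; exact h t ht f S hf x⟩⟩) μ⁻¹
  set ε : ℝ → ℝ := fun t => if t ≤ 0 then 0 else (D t)⁻¹ with hε
  have hεpos : ∀ t, 0 < t → ε t = (D t)⁻¹ := fun t ht => by
    simp only [hε, if_neg (not_le.2 ht)]
  have hε0 : ∀ t, t ≤ 0 → ε t = 0 := fun t ht => by simp only [hε, if_pos ht]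
  refine ⟨ε, E, ⟨?_, ?_, hε0 0 le_rfl, ?_⟩, ⟨hEc, hEa, hElim, fun t ht => (hE t ht).1⟩, ?_⟩
  · intro t ht
    rcases (show (0 : ℝ) ≤ t from ht).eq_or_lt with rfl | ht0
    · rw [← continuousWithinAt_Ioi_iff_Ici, ContinuousWithinAt, hε0 0 le_rfl]
      refine hDlim.inv_tendsto_atTop.congr' ?_
      filter_upwards [self_mem_nhdsWithin] with r hr using (hεpos r hr).symm
    · have h1 : ContinuousAt (fun t => (D t)⁻¹) t :=
        (hDc.continuousAt (Ioi_mem_nhds ht0)).inv₀ (hD t ht0).2.1.ne'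
      refine (h1.congr ?_).continuousWithinAt
      filter_upwards [Ioi_mem_nhds ht0] with r hr using (hεpos r hr).symm
  · intro s hs t ht hst
    rcases (show (0 : ℝ) ≤ s from hs).eq_or_lt with rfl | hs0
    · rw [hε0 0 le_rfl]
      rcases (show (0 : ℝ) ≤ t from ht).eq_or_lt with rfl | ht0
      · rw [hε0 0 le_rfl]
      · rw [hεpos t ht0]
        exact (inv_pos.2 (hD t ht0).2.1).le
    · have ht0 := hs0.trans_le hst
      rw [hεpos s hs0, hεpos t ht0]
      exact inv_anti₀ (hD t ht0).2.1 (hDa hs0 ht0 hst)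
  · intro t ht
    rw [hεpos t ht]
    exact ⟨inv_pos.2 (hD t ht).2.1, inv_lt_of_inv_lt₀ hμ (hD t ht).1⟩
  · intro f S hf x t ht
    rw [hεpos t ht]
    exact ⟨(hD t ht).2.2 f S hf x, (hE t ht).2 f S hf x⟩

end QuasistaticVisco

open QuasistaticVisco in
theorem corollaryc (σ : ℝ → ℝ)
    (h1 : QuasistaticVisco.H1 σ) (h2 : QuasistaticVisco.H2 σ) (l1 : QuasistaticVisco.L1 σ)
    (u1 : QuasistaticVisco.U1 σ) (u2 : QuasistaticVisco.U2 σ)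
    (μ : ℝ) (hμ : 0 < μ) :
    ∃ ε E : ℝ → ℝ,
      (ContinuousOn ε (Ici 0) ∧ MonotoneOn ε (Ici 0) ∧ ε 0 = 0 ∧
        ∀ t : ℝ, 0 < t → 0 < ε t ∧ ε t < μ) ∧
      (ContinuousOn E (Ioi 0) ∧ AntitoneOn E (Ioi 0) ∧ Tendsto E (𝓝[>] 0) atTop ∧
        ∀ t : ℝ, 0 < t → μ < E t) ∧
      ∀ p₀ : ℝ → ℝ, MemLp p₀ 2 QuasistaticVisco.unitMeasure →
        (∀ᵐ x ∂QuasistaticVisco.unitMeasure, 0 ≤ p₀ x) →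
        (∫ x, p₀ x ∂QuasistaticVisco.unitMeasure) = μ →
        ∃ p : ℝ → ℝ → ℝ,
          (∀ T : ℝ, 0 < T → QuasistaticVisco.IsSolution σ p₀ T p) ∧
          (∀ t : ℝ, 0 ≤ t → (∫ x, p x t ∂QuasistaticVisco.unitMeasure) = μ) ∧
          (∀ T : ℝ, 0 < T → ∀ q : ℝ → ℝ → ℝ, QuasistaticVisco.IsSolution σ p₀ T q →
            ∀ t ∈ Icc 0 T,
              (fun x => q x t) =ᵐ[QuasistaticVisco.unitMeasure] fun x => p x t) ∧
          ∀ t : ℝ, 0 < t → ∀ᵐ x ∂QuasistaticVisco.unitMeasure, ε t ≤ p x t ∧ p x t ≤ E t := by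
  have hσ : Admissible σ := admissible_of_hypotheses h1 h2 l1 u1 u2
  -- nothing is known about `σ` on `(-∞, 0]`; setting it to `0` there makes it measurable
  have heq : EqOn ((Ioi 0).indicator σ) σ (Ioi 0) := fun x hx => indicator_of_mem hx σ
  have hσ' : Admissible ((Ioi 0).indicator σ) := hσ.congr heq
  have hm := measurable_indicator_Ioi hσ
  obtain ⟨ε, E, hε, hE, hbound⟩ := exists_bounds hσ' hμ
  refine ⟨ε, E, hε, hE, fun p₀ hp h0 hmean => ?_⟩
  have happrox : ∀ n : ℕ, ∃ f S, ∃ hf : RegularFlow ((Ioi 0).indicator σ) μ f S,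
      ‖hf.toLp 0 - hp.toLp‖ ≤ (1 / 2) ^ n := by
    intro n
    obtain ⟨φ, a₀, b₀, hφ, ha₀, hφab, hlow, hφmean, hφp⟩ :=
      exists_approx_initial hp h0 hmean hμ (show (0 : ℝ) < ((1 / 2) ^ n) ^ 2 by positivity)
    obtain ⟨f, S, hf, hf0⟩ := exists_regularFlow hσ' hm hφ ha₀ hφab hlow hφmean
    refine ⟨f, S, hf, (sq_le_sq₀ (norm_nonneg _) (by positivity)).1 (le_trans (le_of_eq ?_) hφp.le)⟩
    rw [norm_sq_eq_integral]
    apply integral_congr_ae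
    filter_upwards [hf.coeFn_toLp le_rfl, hp.coeFn_toLp, Lp.coeFn_sub (hf.toLp 0) hp.toLp]
      with x h1 h2 h3
    rw [h3, Pi.sub_apply, h1, h2, hf0]
  choose f S hf hfp using happrox
  obtain ⟨p, hpsol, hpbound⟩ := exists_solution_of_approx hσ' hm hp hf hfp
    (fun t ht => (hε.2.2.2 t ht).1) (hε.2.1.mono Ioi_subset_Ici_self) hE.2.1
    (fun n x t ht => hbound (f n) (S n) (hf n) x t ht)
  have hpsol' : ∀ T, IsSolution σ p₀ T p := fun T => (hpsol T).congr_stress fun x hx => (heq hx).symm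
  exact ⟨p, fun T _ => hpsol' T,
    fun t ht => (hpsol' t).integral_eq hσ hμ hmean t ⟨ht, le_rfl⟩,
    fun T _ q hq => (hpsol' T).unique hq hσ hμ hmean, hpbound⟩
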